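/- Let $M$ be a smooth manifold of dimension $n\ge 3$, let $G$ be a spray on $M$, i.e. a vector field on $TM$ which in standard local coordinates $(x^i,y^i)$ is $G=y^i\partial_{x^i}-2G^i\partial_{y^i}$ with $G^i(x,y)$ smooth for $y\neq0$ and $G^i(x,\lambda y)=\lambda^2G^i(x,y)$ for $\lambda>0$, and let $dV=\sigma(x)\,dx^1\cdots dx^n$ ($\sigma>0$) be a smooth volume form on $M$. Notation: for a spray $G$, put $N^i_j=\partial G^i/\partial y^j$, $\Gamma^i_{jk}=\partial^2G^i/\partial y^j\partial y^k$, $\frac{\delta}{\delta x^k}=\frac{\partial}{\partial x^k}-N^m_k\frac{\partial}{\partial y^m}$, $$R_j{}^i{}_{kl}=\frac{\delta\Gamma^i_{jl}}{\delta x^k}-\frac{\delta\Gamma^i_{jk}}{\delta x^l}+\Gamma^i_{ks}\Gamma^s_{jl}-\Gamma^s_{jk}\Gamma^i_{ls},\qquad R^i{}_k=y^jR_j{}^i{}_{kl}y^l,\qquad R=\frac1{n-1}R^m{}_m .$$ Let $\cdot k$ denote $\partial/\partial y^k$ and $|k$ the horizontal covariant derivative of the Berwald connection $\Gamma^i_{jk}$,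 so that $f_{|k}=\delta f/\delta x^k$ and $T_{k|m}=\delta T_k/\delta x^m-\Gamma^s_{km}T_s$. Define $$\eta_k=\tfrac12R_{\cdot k|m}y^m-R_{|k}.$$ The S-curvature of $(G,dV)$ is $S=\partial G^m/\partial y^m-y^m\partial_{x^m}\ln\sigma$, and the spray $\hat G$ associated with $(G,dV)$ is given by $\hat G^i=G^i-\frac{S}{n+1}y^i$. Let $\hat\eta$ be the quantity $\eta$ of $\hat G$. Then, on nonzero tangent vectors, $\hat\eta$ is a projective invariant for fixed $dV$: if $G'$ is a spray with $G'^i=G^i+Py^i$ for some function $P$ on the nonzero tangent vectors, then the quantities $\hat\eta$ of $(G',dV)$ and $(G,dV)$ agree. Moreover, if $G$ is of scalar curvature, i.e. $R^i{}_k=R\,\delta^i_k-\tau_ky^i$ with $\tau_k$ positively homogeneous of degree one in $y$ and $\tau_ky^k=R$, then $\hat\eta=0$. -/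

import Mathlib

open scoped Manifold ContDiff Topology

set_option linter.unusedSectionVars false

noncomputable section

namespace SprayGeometry

/-- The coordinate space `ℝⁿ`, used both for the base coordinates `x` and the fibre coordinates `y`. -/
abbrev Coord (n : ℕ) : Type := EuclideanSpace ℝ (Fin n)

/-- The `i`-th standard basis vector of `ℝⁿ`. -/
abbrev stdVec {n : ℕ} (i : Fin n) : Coord n := EuclideanSpace.single i (1 : ℝ)

section LocalFormulas

variable {n : ℕ}

/-- `∂f/∂xᵏ` of a function `f(x, y)`. -/
def pdx (k : Fin n) (f : Coord n → Coord n → ℝ) (x y : Coord n) : ℝ :=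
  fderiv ℝ (fun z => f z y) x (stdVec k)

/-- `f_{·k} = ∂f/∂yᵏ` of a function `f(x, y)`. -/
def pdy (k : Fin n) (f : Coord n → Coord n → ℝ) (x y : Coord n) : ℝ :=
  fderiv ℝ (fun z => f x z) y (stdVec k)

/-- `N^i_j = ∂G^i/∂y^j`. -/
def connN (G : Coord n → Coord n → Coord n) (i j : Fin n) : Coord n → Coord n → ℝ :=
  pdy j (fun x y => G x y i)

/-- The Berwald connection coefficients `Γ^i_{jk} = ∂²G^i/∂y^j∂y^k`. -/
def berwaldΓ (G : Coord n → Coord n → Coord n) (i j k : Fin n) : Coord n → Coord n → ℝ :=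
  pdy k (connN G i j)

/-- The horizontal derivative `δ/δx^k = ∂/∂x^k - N^m_k ∂/∂y^m`; on scalars `f` this is `f_{|k}`. -/
def hor (G : Coord n → Coord n → Coord n) (k : Fin n) (f : Coord n → Coord n → ℝ)
    (x y : Coord n) : ℝ :=
  pdx k f x y - ∑ m, connN G m k x y * pdy m f x y

/-- The horizontal covariant derivative `T_{k|m}` (Berwald connection) of a covector `T_k(x, y)`. -/
def horCov (G : Coord n → Coord n → Coord n) (T : Fin n → Coord n → Coord n → ℝ)
    (k m : Fin n) (x y : Coord n) : ℝ :=
  hor G m (T k) x y - ∑ s, berwaldΓ G s k m x y * T s x y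

/-- The Riemann curvature tensor of the Berwald connection,
`R_j^i_{kl} = δΓ^i_{jl}/δx^k - δΓ^i_{jk}/δx^l + Γ^i_{ks} Γ^s_{jl} - Γ^s_{jk} Γ^i_{ls}`. -/
def riemann4 (G : Coord n → Coord n → Coord n) (j i k l : Fin n) (x y : Coord n) : ℝ :=
  hor G k (berwaldΓ G i j l) x y - hor G l (berwaldΓ G i j k) x y
    + ∑ s, (berwaldΓ G i k s x y * berwaldΓ G s j l x y
        - berwaldΓ G s j k x y * berwaldΓ G i l s x y)

/-- The two-index Riemann curvature `R^i_k = y^j R_j^i_{kl} y^l`. -/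
def riemann2 (G : Coord n → Coord n → Coord n) (i k : Fin n) (x y : Coord n) : ℝ :=
  ∑ j, ∑ l, y j * riemann4 G j i k l x y * y l

/-- The Ricci curvature `Ric = R^m_m = R_j^m_{ml} y^j y^l`. -/
def ricci (G : Coord n → Coord n → Coord n) (x y : Coord n) : ℝ :=
  ∑ m, riemann2 G m m x y

/-- The curvature scalar `R = Ric / (n - 1)`. -/
def scalR (G : Coord n → Coord n → Coord n) (x y : Coord n) : ℝ :=
  ricci G x y / ((n : ℝ) - 1)

/-- The quantity `η_k = ½ R_{·k|m} y^m - R_{|k}`. -/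
def localEta (G : Coord n → Coord n → Coord n) (k : Fin n) (x y : Coord n) : ℝ :=
  1 / 2 * ∑ m, horCov G (fun s => pdy s (scalR G)) k m x y * y m - hor G k (scalR G) x y

/-- The S-curvature `S = ∂G^m/∂y^m - y^m ∂(ln σ)/∂x^m` of a spray with coefficients `G^i`
with respect to the volume `σ(x) dx¹⋯dxⁿ`. -/
def localS (G : Coord n → Coord n → Coord n) (σ : Coord n → ℝ) (x y : Coord n) : ℝ :=
  ∑ m, pdy m (fun x y => G x y m) x y - ∑ m, y m * pdx m (fun x _ => Real.log (σ x)) x y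

end LocalFormulas

section Global

variable {n : ℕ} {M : Type*} [TopologicalSpace M] [ChartedSpace (Coord n) M]
  [IsManifold (𝓡 n) ∞ M]

/-- The tangent vector `y^i ∂/∂x^i` at the point with coordinates `x` in the chart `e`. -/
def coordVec (e : OpenPartialHomeomorph M (Coord n)) (x y : Coord n) : TangentBundle (𝓡 n) M :=
  ⟨e.symm x, mfderiv (𝓡 n) (𝓡 n) e.symm x y⟩

/-- The standard coordinates `(x, y)` on `TM` induced by a chart `e` of `M`. -/
def tangentCoord (e : OpenPartialHomeomorph M (Coord n)) (v : TangentBundle (𝓡 n) M) :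
    Coord n × Coord n :=
  (e v.proj, mfderiv (𝓡 n) (𝓡 n) e v.proj v.2)

/-- The components, in the coordinates `(x, y)` of `TM` induced by `e`, of a vector field `ξ` on `TM`
at the point with coordinates `(x, y)`. -/
def fieldComp (ξ : (v : TangentBundle (𝓡 n) M) → TangentSpace (𝓡 n).tangent v)
    (e : OpenPartialHomeomorph M (Coord n)) (x y : Coord n) : Coord n × Coord n :=
  mfderiv (𝓡 n).tangent 𝓘(ℝ, Coord n × Coord n) (tangentCoord e) (coordVec e x y)
    (ξ (coordVec e x y))

/-- The local coefficients `G^i` of `ξ = y^i ∂/∂x^i - 2 G^i ∂/∂y^i` in the chart `e`. -/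
def fieldCoeff (ξ : (v : TangentBundle (𝓡 n) M) → TangentSpace (𝓡 n).tangent v)
    (e : OpenPartialHomeomorph M (Coord n)) (x y : Coord n) : Coord n :=
  (-(1 / 2 : ℝ)) • (fieldComp ξ e x y).2

/-- The radial (Liouville) vector field on `TM`: in coordinates, `y^i ∂/∂y^i`. -/
def liouville (v : TangentBundle (𝓡 n) M) : TangentSpace (𝓡 n).tangent v :=
  (mfderiv 𝓘(ℝ, ℝ) (𝓡 n).tangent
    (fun t : ℝ => (⟨v.proj, t • v.2⟩ : TangentBundle (𝓡 n) M)) 1 (1 : ℝ) :)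

variable (n M)

/-- A spray on `M`: a vector field on `TM` which in each standard local coordinate system is
`y^i ∂/∂x^i - 2 G^i ∂/∂y^i`, with `G^i` smooth on nonzero vectors and
`G^i(x, λ y) = λ² G^i(x, y)` for `λ > 0`. -/
structure Spray where
  toFun : (v : TangentBundle (𝓡 n) M) → TangentSpace (𝓡 n).tangent v
  comp_fst : ∀ e ∈ IsManifold.maximalAtlas (𝓡 n) ∞ M, ∀ x ∈ e.target, ∀ y : Coord n,
    (fieldComp toFun e x y).1 = y
  smooth : ∀ e ∈ IsManifold.maximalAtlas (𝓡 n) ∞ M,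
    ContDiffOn ℝ ∞ (fun z : Coord n × Coord n => fieldCoeff toFun e z.1 z.2)
      (e.target ×ˢ {y | y ≠ 0})
  homog : ∀ e ∈ IsManifold.maximalAtlas (𝓡 n) ∞ M, ∀ x ∈ e.target, ∀ y : Coord n,
    ∀ c : ℝ, 0 < c → fieldCoeff toFun e x (c • y) = c ^ 2 • fieldCoeff toFun e x y

/-- The volume coefficient `σ(x)` of a volume element in the chart `e`: its value on the coordinate
frame `∂/∂x¹, …, ∂/∂xⁿ`. -/
def frameValue {n : ℕ} {M : Type*} [TopologicalSpace M] [ChartedSpace (Coord n) M]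
    (μ : (p : M) → (Fin n → TangentSpace (𝓡 n) p) → ℝ)
    (e : OpenPartialHomeomorph M (Coord n)) (x : Coord n) : ℝ :=
  μ (e.symm x) (fun i => mfderiv (𝓡 n) (𝓡 n) e.symm x (stdVec i))

/-- A volume form `dV = σ(x) dx¹⋯dxⁿ`, `σ > 0`, on a (not necessarily oriented) manifold: at each
point it is the absolute value of a nonzero alternating `n`-form, and its coefficient `σ` in each
chart is smooth. On an oriented manifold a nowhere vanishing smooth `n`-form `ω` gives `|ω|`. -/
structure VolumeForm where
  toFun : (p : M) → (Fin n → TangentSpace (𝓡 n) p) → ℝ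
  exists_form : ∀ p : M, ∃ α : (TangentSpace (𝓡 n) p) [⋀^Fin n]→ₗ[ℝ] ℝ,
    α ≠ 0 ∧ ∀ v, toFun p v = |α v|
  smooth : ∀ e ∈ IsManifold.maximalAtlas (𝓡 n) ∞ M, ContDiffOn ℝ ∞ (frameValue toFun e) e.target

variable {n M}

/-- The coefficients `G^i` of a spray in the chart `e`. -/
def Spray.coeff (G : Spray n M) (e : OpenPartialHomeomorph M (Coord n)) :
    Coord n → Coord n → Coord n :=
  fieldCoeff G.toFun e

/-- The coefficient `σ` of a volume form in the chart `e`. -/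
def VolumeForm.coeff (dV : VolumeForm n M) (e : OpenPartialHomeomorph M (Coord n)) :
    Coord n → ℝ :=
  frameValue dV.toFun e

/-- The S-curvature of `(G, dV)`, a function on `TM`; it is computed in the preferred chart at the
base point, and `Spray.sCurvature_eq` shows that every chart gives the same value. -/
def Spray.sCurvature (G : Spray n M) (dV : VolumeForm n M) (v : TangentBundle (𝓡 n) M) : ℝ :=
  localS (G.coeff (chartAt (Coord n) v.proj)) (dV.coeff (chartAt (Coord n) v.proj))
    (tangentCoord (chartAt (Coord n) v.proj) v).1 (tangentCoord (chartAt (Coord n) v.proj) v).2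

local notation "𝓜" => IsManifold.maximalAtlas (𝓡 n) ∞ M

theorem one_add_one_le_infty : (1 : WithTop ℕ∞) + 1 ≤ ∞ := by
  rw [one_add_one_eq_two]
  exact WithTop.coe_le_coe.2 le_top

theorem mdiff_chart {e : OpenPartialHomeomorph M (Coord n)} (he : e ∈ 𝓜) {p : M}
    (hp : p ∈ e.source) : MDifferentiableAt (𝓡 n) (𝓡 n) e p :=
  (contMDiffAt_of_mem_maximalAtlas he hp).mdifferentiableAt (by simp)

theorem mdiff_chart_symm {e : OpenPartialHomeomorph M (Coord n)} (he : e ∈ 𝓜) {x : Coord n}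
    (hx : x ∈ e.target) : MDifferentiableAt (𝓡 n) (𝓡 n) e.symm x :=
  (contMDiffAt_symm_of_mem_maximalAtlas he hx).mdifferentiableAt (by simp)

theorem contDiffAt_transition {e e' : OpenPartialHomeomorph M (Coord n)} (he : e ∈ 𝓜)
    (he' : e' ∈ 𝓜) {x : Coord n} (hx : x ∈ e.target) (hx' : e.symm x ∈ e'.source) :
    ContDiffAt ℝ ∞ (e' ∘ e.symm) x := by
  rw [← contMDiffAt_iff_contDiffAt]
  exact (contMDiffAt_of_mem_maximalAtlas he' hx').comp x
    (contMDiffAt_symm_of_mem_maximalAtlas he hx)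

theorem tangentCoord_coordVec {e e' : OpenPartialHomeomorph M (Coord n)} (he : e ∈ 𝓜)
    (he' : e' ∈ 𝓜) {x : Coord n} (hx : x ∈ e.target) (hx' : e.symm x ∈ e'.source) (y : Coord n) :
    tangentCoord e' (coordVec e x y) =
      ((e' ∘ e.symm) x, fderiv ℝ (e' ∘ e.symm) x y) := by
  have h := mfderiv_comp x (mdiff_chart he' hx') (mdiff_chart_symm he hx)
  rw [mfderiv_eq_fderiv] at h
  rw [h]
  rfl

theorem tangentCoord_coordVec_self {e : OpenPartialHomeomorph M (Coord n)} (he : e ∈ 𝓜)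
    {x : Coord n} (hx : x ∈ e.target) (y : Coord n) :
    tangentCoord e (coordVec e x y) = (x, y) := by
  rw [tangentCoord_coordVec he he hx (e.map_target hx)]
  have : (e ∘ e.symm) =ᶠ[𝓝 x] id := by
    filter_upwards [e.open_target.mem_nhds hx] with z hz using e.right_inv hz
  rw [this.fderiv_eq, this.eq_of_nhds]
  simp

theorem mfderiv_symm_comp {e : OpenPartialHomeomorph M (Coord n)} (he : e ∈ 𝓜) {p : M}
    (hp : p ∈ e.source) (w : TangentSpace (𝓡 n) p) :
    mfderiv (𝓡 n) (𝓡 n) e.symm (e p) (mfderiv (𝓡 n) (𝓡 n) e p w) = (w : Coord n) := by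
  have h := mfderiv_comp p (mdiff_chart_symm he (e.map_source hp)) (mdiff_chart he hp)
  have : (e.symm ∘ e) =ᶠ[𝓝 p] id := by
    filter_upwards [e.open_source.mem_nhds hp] with z hz using e.left_inv hz
  rw [this.mfderiv_eq, mfderiv_id] at h
  exact (congrArg (fun L : Coord n →L[ℝ] Coord n => L w) h).symm

theorem coordVec_tangentCoord {e : OpenPartialHomeomorph M (Coord n)} (he : e ∈ 𝓜)
    {v : TangentBundle (𝓡 n) M} (hv : v.proj ∈ e.source) :
    coordVec e (tangentCoord e v).1 (tangentCoord e v).2 = v := by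
  obtain ⟨p, w⟩ := v
  have h2 := mfderiv_symm_comp he hv w
  have h1 : e.symm (e p) = p := e.left_inv hv
  simp only [coordVec, tangentCoord]
  refine Bundle.TotalSpace.ext h1 ?_
  exact heq_of_eq h2

theorem mdiff_tangentCoord {e : OpenPartialHomeomorph M (Coord n)} (he : e ∈ 𝓜)
    {v : TangentBundle (𝓡 n) M} (hv : v.proj ∈ e.source) :
    MDifferentiableAt (𝓡 n).tangent 𝓘(ℝ, Coord n × Coord n) (tangentCoord e) v := by
  have hopen : IsOpen (Bundle.TotalSpace.proj ⁻¹' e.source : Set (TangentBundle (𝓡 n) M)) :=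
    e.open_source.preimage (FiberBundle.continuous_proj (Coord n) (TangentSpace (𝓡 n) (M := M)))
  have h0 : ContMDiffOn (𝓡 n) (𝓡 n) ∞ e e.source := contMDiffOn_of_mem_maximalAtlas he
  have h1 := h0.contMDiffOn_tangentMapWithin (m := 1) one_add_one_le_infty e.open_source.uniqueMDiffOn
  have h2 : ContMDiffAt (𝓡 n).tangent (𝓡 n).tangent 1 (tangentMapWithin (𝓡 n) (𝓡 n) e e.source) v :=
    h1.contMDiffAt (hopen.mem_nhds hv)
  have h3 : ContMDiffAt (𝓡 n).tangent 𝓘(ℝ, Coord n) 1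
      (fun v => (tangentMapWithin (𝓡 n) (𝓡 n) e e.source v).2) v :=
    (contMDiff_snd_tangentBundle_modelSpace (Coord n) 𝓘(ℝ, Coord n)).contMDiffAt.comp v h2
  have h4 : ContMDiffAt (𝓡 n).tangent 𝓘(ℝ, Coord n) 1
      (fun v : TangentBundle (𝓡 n) M => e v.proj) v :=
    ((contMDiffAt_of_mem_maximalAtlas he hv).of_le (by simp)).comp v
      (Bundle.contMDiff_proj (TangentSpace (𝓡 n) (M := M))).contMDiffAt
  have h5 := (h4.prodMk_space h3).mdifferentiableAt (by simp)
  refine h5.congr_of_eventuallyEq ?_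
  filter_upwards [hopen.mem_nhds hv] with w hw
  simp only [tangentCoord, tangentMapWithin, mfderivWithin_of_isOpen e.open_source hw]

/-- Change of the induced coordinates on the tangent bundle. -/
def coordChange (τ : Coord n → Coord n) (z : Coord n × Coord n) : Coord n × Coord n :=
  (τ z.1, fderiv ℝ τ z.1 z.2)

theorem hasFDerivAt_coordChange {τ : Coord n → Coord n} {x : Coord n} (h : ContDiffAt ℝ ∞ τ x)
    (y a b : Coord n) :
    DifferentiableAt ℝ (coordChange τ) (x, y) ∧ fderiv ℝ (coordChange τ) (x, y) (a, b) =
      (fderiv ℝ τ x a, fderiv ℝ (fderiv ℝ τ) x a y + fderiv ℝ τ x b) := by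
  have d1 : DifferentiableAt ℝ τ x := h.differentiableAt (by simp)
  have d2 : DifferentiableAt ℝ (fderiv ℝ τ) x :=
    (h.fderiv_right (m := 1) one_add_one_le_infty).differentiableAt (by simp)
  have f1 : HasFDerivAt (fun z : Coord n × Coord n => τ z.1)
      ((fderiv ℝ τ x).comp (ContinuousLinearMap.fst ℝ _ _)) (x, y) :=
    HasFDerivAt.comp (x, y) (f := Prod.fst) d1.hasFDerivAt hasFDerivAt_fst
  have f2 : HasFDerivAt (fun z : Coord n × Coord n => fderiv ℝ τ z.1)
      ((fderiv ℝ (fderiv ℝ τ) x).comp (ContinuousLinearMap.fst ℝ _ _)) (x, y) :=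
    HasFDerivAt.comp (x, y) (f := Prod.fst) (g := fderiv ℝ τ) d2.hasFDerivAt hasFDerivAt_fst
  have f3 := f2.clm_apply (hasFDerivAt_snd (𝕜 := ℝ) (p := (x, y)))
  have f4 : HasFDerivAt (coordChange τ) _ (x, y) := f1.prodMk f3
  refine ⟨f4.differentiableAt, ?_⟩
  rw [f4.fderiv]
  simp [add_comm]

theorem mfderiv_tangentCoord {e e' : OpenPartialHomeomorph M (Coord n)} (he : e ∈ 𝓜)
    (he' : e' ∈ 𝓜) {x : Coord n} (hx : x ∈ e.target) (hx' : e.symm x ∈ e'.source) (y : Coord n)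
    (ζ : TangentSpace (𝓡 n).tangent (coordVec e x y)) :
    mfderiv (𝓡 n).tangent 𝓘(ℝ, Coord n × Coord n) (tangentCoord e') (coordVec e x y) ζ =
      (fderiv ℝ (coordChange (e' ∘ e.symm)) (x, y)
        (mfderiv (𝓡 n).tangent 𝓘(ℝ, Coord n × Coord n) (tangentCoord e) (coordVec e x y) ζ) :
        Coord n × Coord n) := by
  set v := coordVec e x y with hv
  have hvs : v.proj ∈ e.source := e.map_target hx
  have hvs' : v.proj ∈ e'.source := hx'
  have hopen : IsOpen (Bundle.TotalSpace.proj ⁻¹' (e.source ∩ e'.source) :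
      Set (TangentBundle (𝓡 n) M)) :=
    (e.open_source.inter e'.open_source).preimage
      (FiberBundle.continuous_proj (Coord n) (TangentSpace (𝓡 n) (M := M)))
  have hxy : tangentCoord e v = (x, y) := tangentCoord_coordVec_self he hx y
  have hev : tangentCoord e' =ᶠ[𝓝 v] coordChange (e' ∘ e.symm) ∘ tangentCoord e := by
    filter_upwards [hopen.mem_nhds ⟨hvs, hvs'⟩] with w hw
    have h1 := coordVec_tangentCoord he hw.1
    have hmem : (tangentCoord e w).1 ∈ e.target := e.map_source hw.1
    have h2 := tangentCoord_coordVec he he' hmem (by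
      simp only [tangentCoord]; rw [e.left_inv hw.1]; exact hw.2) (tangentCoord e w).2
    rw [h1] at h2
    rw [h2]; rfl
  have hd := (hasFDerivAt_coordChange (contDiffAt_transition he he' hx hx') y 0 0).1
  rw [← hxy] at hd
  have hc := mfderiv_comp v hd.mdifferentiableAt (mdiff_tangentCoord he hvs)
  rw [mfderiv_eq_fderiv, hxy] at hc
  rw [hev.mfderiv_eq, hc]
  rfl

theorem Spray.coeff_transform (G : Spray n M) {e e' : OpenPartialHomeomorph M (Coord n)}
    (he : e ∈ 𝓜) (he' : e' ∈ 𝓜) {x : Coord n} (hx : x ∈ e.target)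
    (hx' : e.symm x ∈ e'.source) (y : Coord n) :
    G.coeff e' ((e' ∘ e.symm) x) (fderiv ℝ (e' ∘ e.symm) x y) =
      fderiv ℝ (e' ∘ e.symm) x (G.coeff e x y)
        - (1 / 2 : ℝ) • fderiv ℝ (fderiv ℝ (e' ∘ e.symm)) x y y := by
  have hv : coordVec e' ((e' ∘ e.symm) x) (fderiv ℝ (e' ∘ e.symm) x y) = coordVec e x y := by
    have h := coordVec_tangentCoord (v := coordVec e x y) he' hx'
    rwa [tangentCoord_coordVec he he' hx hx'] at h
  have h1 := mfderiv_tangentCoord he he' hx hx' y (G.toFun (coordVec e x y))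
  have h2 := G.comp_fst e he x hx y
  simp only [Spray.coeff, fieldCoeff, fieldComp] at *
  rw [hv]
  erw [h1]
  set ζ : Coord n × Coord n := mfderiv (𝓡 n).tangent 𝓘(ℝ, Coord n × Coord n) (tangentCoord e)
    (coordVec e x y) (G.toFun (coordVec e x y)) with hζ
  have h3 : ζ = (y, ζ.2) := Prod.ext h2 rfl
  rw [h3, (hasFDerivAt_coordChange (contDiffAt_transition he he' hx hx') y y ζ.2).2]
  simp only [map_smul, smul_add]
  module

theorem hasDerivAt_det_line (A : Matrix (Fin n) (Fin n) ℝ) :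
    HasDerivAt (fun t : ℝ => (1 + t • A).det) A.trace 0 := by
  have h : (fun t : ℝ => (1 + t • A).det) = fun t => 1 + A.trace * t +
      (Matrix.det (1 + (Polynomial.X : Polynomial ℝ) • A.map Polynomial.C)).divX.divX.eval t * t ^ 2 := by
    funext t
    exact Matrix.det_one_add_smul t A
  rw [h]
  set P := (Matrix.det (1 + (Polynomial.X : Polynomial ℝ) • A.map Polynomial.C)).divX.divX
  have h1 := (((hasDerivAt_id (0 : ℝ)).const_mul A.trace).const_add 1).add
    ((P.hasDerivAt 0).mul ((hasDerivAt_id (0 : ℝ)).pow 2))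
  refine h1.congr_deriv ?_
  simp

theorem differentiable_clmDet :
    Differentiable ℝ (fun A : Coord n →L[ℝ] Coord n => LinearMap.det (A : Coord n →ₗ[ℝ] Coord n)) := by
  have h : (fun A : Coord n →L[ℝ] Coord n => LinearMap.det (A : Coord n →ₗ[ℝ] Coord n)) =
      fun A : Coord n →L[ℝ] Coord n => ∑ p : Equiv.Perm (Fin n), (Equiv.Perm.sign p : ℤ) * ∏ i, (A (stdVec i)) (p i) := by
    funext A
    rw [← LinearMap.det_toMatrix (EuclideanSpace.basisFun (Fin n) ℝ).toBasis, Matrix.det_apply']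
    simp [LinearMap.toMatrix_apply]
  rw [h]
  have h2 : ∀ i j : Fin n, Differentiable ℝ (fun A : Coord n →L[ℝ] Coord n => (A (stdVec i)) j) :=
    fun i j => ((EuclideanSpace.proj j : Coord n →L[ℝ] ℝ).comp
      (ContinuousLinearMap.apply ℝ (Coord n) (stdVec i))).differentiable
  fun_prop

theorem fderiv_det_apply (A B C : Coord n →L[ℝ] Coord n)
    (hB : A.comp B = ContinuousLinearMap.id ℝ _) :
    fderiv ℝ (fun A : Coord n →L[ℝ] Coord n => LinearMap.det (A : Coord n →ₗ[ℝ] Coord n)) A C =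
      LinearMap.det (A : Coord n →ₗ[ℝ] Coord n) *
        LinearMap.trace ℝ (Coord n) (B.comp C : Coord n →ₗ[ℝ] Coord n) := by
  have hline : HasDerivAt (fun t : ℝ => LinearMap.det ((A + t • C : Coord n →L[ℝ] Coord n) :
      Coord n →ₗ[ℝ] Coord n))
      (fderiv ℝ (fun A : Coord n →L[ℝ] Coord n => LinearMap.det (A : Coord n →ₗ[ℝ] Coord n))
        A C) 0 := by
    have h1 : HasDerivAt (fun t : ℝ => A + t • C) C 0 := by
      simpa using ((hasDerivAt_id (0 : ℝ)).smul_const C).const_add A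
    exact (differentiable_clmDet A).hasFDerivAt.comp_hasDerivAt_of_eq (0 : ℝ) h1
      (((congrArg (A + ·) (zero_smul ℝ C)).trans (add_zero A)).symm)
  have hline2 : HasDerivAt (fun t : ℝ => LinearMap.det ((A + t • C : Coord n →L[ℝ] Coord n) :
      Coord n →ₗ[ℝ] Coord n))
      (LinearMap.det (A : Coord n →ₗ[ℝ] Coord n) *
        LinearMap.trace ℝ (Coord n) (B.comp C : Coord n →ₗ[ℝ] Coord n)) 0 := by
    set b := (EuclideanSpace.basisFun (Fin n) ℝ).toBasis
    have h1 := (hasDerivAt_det_line (LinearMap.toMatrix b b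
      (B.comp C : Coord n →ₗ[ℝ] Coord n))).const_mul (LinearMap.det (A : Coord n →ₗ[ℝ] Coord n))
    rw [LinearMap.trace_eq_matrix_trace ℝ b]
    refine h1.congr_of_eventuallyEq (Filter.Eventually.of_forall fun t => ?_)
    have h2 : (A + t • C : Coord n →L[ℝ] Coord n) =
        A.comp (ContinuousLinearMap.id ℝ (Coord n) + t • B.comp C) := by
      rw [ContinuousLinearMap.comp_add, ContinuousLinearMap.comp_smul,
        ← ContinuousLinearMap.comp_assoc, hB]
      simp
    beta_reduce
    rw [h2, ContinuousLinearMap.toLinearMap_comp, LinearMap.det_comp]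
    congr 1
    rw [← LinearMap.det_toMatrix b, ContinuousLinearMap.toLinearMap_add,
      ContinuousLinearMap.toLinearMap_smul, map_add, map_smul]
    congr 2
    exact LinearMap.toMatrix_id b
  exact hline.unique hline2

theorem fderiv_log_det {A : Coord n → Coord n →L[ℝ] Coord n} {x : Coord n}
    (hA : DifferentiableAt ℝ A x) (B : Coord n →L[ℝ] Coord n)
    (hB : (A x).comp B = ContinuousLinearMap.id ℝ _) (y : Coord n) :
    LinearMap.det (A x : Coord n →ₗ[ℝ] Coord n) ≠ 0 ∧
    DifferentiableAt ℝ (fun z => Real.log (LinearMap.det (A z : Coord n →ₗ[ℝ] Coord n))) x ∧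
    fderiv ℝ (fun z => Real.log (LinearMap.det (A z : Coord n →ₗ[ℝ] Coord n))) x y =
      LinearMap.trace ℝ (Coord n) (B.comp (fderiv ℝ A x y) : Coord n →ₗ[ℝ] Coord n) := by
  have hdet : LinearMap.det (A x : Coord n →ₗ[ℝ] Coord n) *
      LinearMap.det (B : Coord n →ₗ[ℝ] Coord n) = 1 := by
    rw [← LinearMap.det_comp, ← ContinuousLinearMap.toLinearMap_comp, hB]
    simp
  have hne : LinearMap.det (A x : Coord n →ₗ[ℝ] Coord n) ≠ 0 := left_ne_zero_of_mul_eq_one hdet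
  have hd : DifferentiableAt ℝ (fun z => LinearMap.det (A z : Coord n →ₗ[ℝ] Coord n)) x :=
    DifferentiableAt.comp (g := fun A : Coord n →L[ℝ] Coord n =>
      LinearMap.det (A : Coord n →ₗ[ℝ] Coord n)) x differentiable_clmDet.differentiableAt hA
  refine ⟨hne, hd.log hne, ?_⟩
  rw [fderiv.log hd hne]
  have hc : fderiv ℝ (fun z => LinearMap.det (A z : Coord n →ₗ[ℝ] Coord n)) x y =
      fderiv ℝ (fun A : Coord n →L[ℝ] Coord n => LinearMap.det (A : Coord n →ₗ[ℝ] Coord n))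
        (A x) (fderiv ℝ A x y) := by
    have := fderiv_comp (g := fun A : Coord n →L[ℝ] Coord n =>
      LinearMap.det (A : Coord n →ₗ[ℝ] Coord n)) x differentiable_clmDet.differentiableAt hA
    exact congrArg (fun L => L y) this
  have := fderiv_det_apply (A x) B (fderiv ℝ A x y) hB
  simp only [smul_apply, hc, this, smul_eq_mul]
  field_simp

theorem fderiv_coord {f : Coord n → Coord n} {y : Coord n} (hf : DifferentiableAt ℝ f y)
    (w : Coord n) (m : Fin n) : fderiv ℝ (fun z => f z m) y w = fderiv ℝ f y w m := by
  have h := ((EuclideanSpace.proj m : Coord n →L[ℝ] ℝ).hasFDerivAt (x := f y)).comp y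
    hf.hasFDerivAt
  have h2 : fderiv ℝ (fun z => f z m) y = _ := h.fderiv
  rw [h2]; rfl

theorem localS_eq {G : Coord n → Coord n → Coord n} {σ : Coord n → ℝ} {x y : Coord n}
    (hG : DifferentiableAt ℝ (G x) y) :
    localS G σ x y = LinearMap.trace ℝ (Coord n) (fderiv ℝ (G x) y : Coord n →ₗ[ℝ] Coord n)
      - fderiv ℝ (fun z => Real.log (σ z)) x y := by
  unfold localS
  congr 1
  · rw [LinearMap.trace_eq_sum_inner _ (EuclideanSpace.basisFun (Fin n) ℝ)]
    refine Finset.sum_congr rfl fun m _ => ?_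
    simp [pdy, fderiv_coord hG, EuclideanSpace.inner_single_left]
  · have hy : y = ∑ m, y m • (stdVec m : Coord n) := by
      have := (EuclideanSpace.basisFun (Fin n) ℝ).sum_repr y
      simpa using this.symm
    conv_rhs => rw [hy, map_sum]
    refine Finset.sum_congr rfl fun m _ => ?_
    rw [map_smul]; rfl

theorem volume_congr (dV : VolumeForm n M) {p q : M} (h : p = q) (f : Fin n → Coord n) :
    dV.toFun p f = dV.toFun q f := by
  subst h; rfl

theorem alt_apply_comp (α : (Coord n) [⋀^Fin n]→ₗ[ℝ] ℝ) (L A : Coord n →L[ℝ] Coord n) :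
    α (fun i => L (A (stdVec i))) =
      α (fun i => L (stdVec i)) * LinearMap.det (A : Coord n →ₗ[ℝ] Coord n) := by
  set b := (EuclideanSpace.basisFun (Fin n) ℝ).toBasis with hb
  have h2 := (α.compLinearMap (L : Coord n →ₗ[ℝ] Coord n)).eq_smul_basis_det b
  have h3 := congrArg (fun β : (Coord n) [⋀^Fin n]→ₗ[ℝ] ℝ => β
    ((A : Coord n →ₗ[ℝ] Coord n) ∘ b)) h2
  simp only [AlternatingMap.smul_apply, Module.Basis.det_comp, Module.Basis.det_self,
    AlternatingMap.compLinearMap_apply, smul_eq_mul, mul_one] at h3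
  have hbs : ∀ i, b i = stdVec i := by intro i; simp [hb]
  simp only [hbs, Function.comp_apply] at h3
  exact h3

theorem alt_eq_zero (α : (Coord n) [⋀^Fin n]→ₗ[ℝ] ℝ) (L L' : Coord n →L[ℝ] Coord n)
    (hL : ∀ w, L (L' w) = w) (h0 : α (fun i => L (stdVec i)) = 0) : α = 0 := by
  have h1 : α.compLinearMap (L : Coord n →ₗ[ℝ] Coord n) = 0 := by
    rw [(α.compLinearMap (L : Coord n →ₗ[ℝ] Coord n)).eq_smul_basis_det
      (EuclideanSpace.basisFun (Fin n) ℝ).toBasis]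
    have : (α.compLinearMap (L : Coord n →ₗ[ℝ] Coord n))
        (EuclideanSpace.basisFun (Fin n) ℝ).toBasis = 0 := by
      rw [← h0, AlternatingMap.compLinearMap_apply]
      simp
    rw [this, zero_smul]
  ext w
  have h2 : α (fun i => L (L' (w i))) = 0 :=
    congrArg (fun β : (Coord n) [⋀^Fin n]→ₗ[ℝ] ℝ => β (fun i => L' (w i))) h1
  simp only [hL] at h2
  exact h2

theorem VolumeForm.coeff_ne_zero (dV : VolumeForm n M) {e : OpenPartialHomeomorph M (Coord n)}
    (he : e ∈ 𝓜) {x : Coord n} (hx : x ∈ e.target) : dV.coeff e x ≠ 0 := by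
  obtain ⟨α, hα, h⟩ := dV.exists_form (e.symm x)
  simp only [coeff, frameValue, h, abs_ne_zero]
  intro h0
  refine hα (alt_eq_zero (n := n) α (mfderiv (𝓡 n) (𝓡 n) e.symm x)
    (mfderiv (𝓡 n) (𝓡 n) e (e.symm x)) (fun w => ?_) h0)
  have h3 := mfderiv_symm_comp he (e.map_target hx) w
  rw [e.right_inv hx] at h3
  exact h3

theorem coordVec_transition {e e' : OpenPartialHomeomorph M (Coord n)}
    (he : e ∈ 𝓜) (he' : e' ∈ 𝓜) {x : Coord n} (hx : x ∈ e.target)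
    (hx' : e.symm x ∈ e'.source) (y : Coord n) :
    coordVec e' ((e' ∘ e.symm) x) (fderiv ℝ (e' ∘ e.symm) x y) = coordVec e x y := by
  have h := coordVec_tangentCoord (v := coordVec e x y) he' hx'
  rwa [tangentCoord_coordVec he he' hx hx'] at h

theorem VolumeForm.coeff_transform (dV : VolumeForm n M)
    {e e' : OpenPartialHomeomorph M (Coord n)} (he : e ∈ 𝓜) (he' : e' ∈ 𝓜) {x : Coord n}
    (hx : x ∈ e.target) (hx' : e.symm x ∈ e'.source) :
    dV.coeff e x = dV.coeff e' ((e' ∘ e.symm) x) *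
      |LinearMap.det (fderiv ℝ (e' ∘ e.symm) x : Coord n →ₗ[ℝ] Coord n)| := by
  set τ := e' ∘ e.symm with hτ
  have hp : e.symm x = e'.symm (τ x) := (e'.left_inv hx').symm
  have hv : ∀ y : Coord n, (mfderiv (𝓡 n) (𝓡 n) e.symm x y : Coord n) =
      (mfderiv (𝓡 n) (𝓡 n) e'.symm (τ x) (fderiv ℝ τ x y) : Coord n) := by
    intro y
    have h := coordVec_transition he he' hx hx' y
    have h2 := congrArg (fun v : TangentBundle (𝓡 n) M => (v.2 : Coord n)) h
    exact h2.symm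
  obtain ⟨α, hα, h⟩ := dV.exists_form (e'.symm (τ x))
  have h1 : dV.coeff e x = dV.toFun (e'.symm (τ x)) (fun i =>
      (mfderiv (𝓡 n) (𝓡 n) e'.symm (τ x) (fderiv ℝ τ x (stdVec i)))) :=
    (volume_congr dV hp _).trans (congrArg (dV.toFun (e'.symm (τ x))) (funext fun i => hv _))
  have h2 := alt_apply_comp (n := n) α (mfderiv (𝓡 n) (𝓡 n) e'.symm (τ x)) (fderiv ℝ τ x)
  rw [h1, h]
  simp only [coeff, frameValue, h]
  rw [← abs_mul]
  exact congrArg abs h2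

theorem isOpen_slit {e : OpenPartialHomeomorph M (Coord n)} :
    IsOpen (e.target ×ˢ {y : Coord n | y ≠ 0}) :=
  e.open_target.prod isOpen_ne

theorem Spray.differentiableAt_coeff (G : Spray n M) {e : OpenPartialHomeomorph M (Coord n)}
    (he : e ∈ 𝓜) {x y : Coord n} (hx : x ∈ e.target) (hy : y ≠ 0) :
    DifferentiableAt ℝ (G.coeff e x) y := by
  have h : ContDiffAt ℝ ∞ (fun z : Coord n × Coord n => G.coeff e z.1 z.2) (x, y) :=
    (G.smooth e he).contDiffAt (isOpen_slit.mem_nhds ⟨hx, hy⟩)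
  exact DifferentiableAt.comp (g := fun z : Coord n × Coord n => G.coeff e z.1 z.2)
    (f := fun y => (x, y)) y (h.differentiableAt (by simp)) (by fun_prop)

theorem VolumeForm.contDiffOn_log (dV : VolumeForm n M) {e : OpenPartialHomeomorph M (Coord n)}
    (he : e ∈ 𝓜) : ContDiffOn ℝ ∞ (fun x => Real.log (dV.coeff e x)) e.target :=
  ContDiffOn.log (dV.smooth e he) fun _ hx => dV.coeff_ne_zero he hx

theorem transition_inverse {e e' : OpenPartialHomeomorph M (Coord n)} (he : e ∈ 𝓜)
    (he' : e' ∈ 𝓜) {x : Coord n} (hx : x ∈ e.target) (hx' : e.symm x ∈ e'.source) :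
    (fderiv ℝ (e ∘ e'.symm) ((e' ∘ e.symm) x)).comp (fderiv ℝ (e' ∘ e.symm) x) =
      ContinuousLinearMap.id ℝ (Coord n) := by
  ext1 y
  have h1 := coordVec_transition he he' hx hx' y
  have h2 := tangentCoord_coordVec he' he (e'.map_source hx')
    (by
      rw [e'.left_inv hx']
      exact e.map_target hx)
    (fderiv ℝ (e' ∘ e.symm) x y)
  have h3 := tangentCoord_coordVec_self he hx y
  rw [← h1] at h3
  exact congrArg Prod.snd (h2.symm.trans h3)

theorem Spray.localS_transform (G : Spray n M) (dV : VolumeForm n M)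
    {e e' : OpenPartialHomeomorph M (Coord n)} (he : e ∈ 𝓜) (he' : e' ∈ 𝓜) {x y : Coord n}
    (hx : x ∈ e.target) (hx' : e.symm x ∈ e'.source) (hy : y ≠ 0) :
    localS (G.coeff e') (dV.coeff e') ((e' ∘ e.symm) x) (fderiv ℝ (e' ∘ e.symm) x y) =
      localS (G.coeff e) (dV.coeff e) x y := by
  set τ := e' ∘ e.symm with hτ
  set A := fderiv ℝ τ x with hA
  set B := fderiv ℝ (e ∘ e'.symm) (τ x) with hB
  set D := fderiv ℝ (fderiv ℝ τ) x with hD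
  have hBA : B.comp A = ContinuousLinearMap.id ℝ _ := transition_inverse he he' hx hx'
  have hAB : A.comp B = ContinuousLinearMap.id ℝ _ := by
    have h := mul_eq_one_comm.1 (congrArg
      (fun L : Coord n →L[ℝ] Coord n => (L : Coord n →ₗ[ℝ] Coord n)) hBA)
    exact ContinuousLinearMap.coe_injective h
  have hAy : A y ≠ 0 := by
    intro h0
    have : B.comp A y = y := by rw [hBA]; rfl
    rw [ContinuousLinearMap.comp_apply, h0, map_zero] at this
    exact hy this.symm
  have hτx : τ x ∈ e'.target := e'.map_source hx'
  have hcd : ContDiffAt ℝ ∞ τ x := contDiffAt_transition he he' hx hx'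
  have dG := G.differentiableAt_coeff he hx hy
  have dG' := G.differentiableAt_coeff he' hτx hAy
  have dA : DifferentiableAt ℝ (fderiv ℝ τ) x :=
    (hcd.fderiv_right (m := 1) one_add_one_le_infty).differentiableAt (by simp)
  have dl := ((dV.contDiffOn_log he').contDiffAt (e'.open_target.mem_nhds hτx)).differentiableAt
    (by simp)
  have hsymm : ∀ u w, D u w = D w u := fun u w =>
    hcd.isSymmSndFDerivAt (by
      rw [minSmoothness_of_isRCLikeNormedField]
      exact WithTop.coe_le_coe.2 le_top) u w
  -- the coefficients
  have hcoef : ∀ w, fderiv ℝ (G.coeff e' (τ x)) (A y) (A w) =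
      A (fderiv ℝ (G.coeff e x) y w) - D y w := by
    have hfun : (fun z => G.coeff e' (τ x) (A z)) =
        fun z => A (G.coeff e x z) - (1 / 2 : ℝ) • D z z :=
      funext fun z => G.coeff_transform he he' hx hx' z
    have h1 : HasFDerivAt (fun z => G.coeff e' (τ x) (A z))
        ((fderiv ℝ (G.coeff e' (τ x)) (A y)).comp A) y :=
      HasFDerivAt.comp y (f := A) dG'.hasFDerivAt A.hasFDerivAt
    have h2 : HasFDerivAt (fun z => A (G.coeff e x z)) (A.comp (fderiv ℝ (G.coeff e x) y)) y :=
      A.hasFDerivAt.comp y dG.hasFDerivAt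
    have h3 := (D.hasFDerivAt (x := y)).clm_apply (hasFDerivAt_id (𝕜 := ℝ) y)
    have h4 := h2.sub (h3.const_smul (1 / 2 : ℝ))
    rw [hfun] at h1
    have h5 := h1.unique h4
    intro w
    have h6 := congrArg (fun L : Coord n →L[ℝ] Coord n => L w) h5
    simp only [ContinuousLinearMap.comp_apply, sub_apply, smul_apply, add_apply,
      ContinuousLinearMap.flip_apply, id_eq, ContinuousLinearMap.id_apply] at h6
    rw [h6, hsymm w y]
    module
  have htr : LinearMap.trace ℝ (Coord n) (fderiv ℝ (G.coeff e' (τ x)) (A y) :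
        Coord n →ₗ[ℝ] Coord n) =
      LinearMap.trace ℝ (Coord n) (fderiv ℝ (G.coeff e x) y : Coord n →ₗ[ℝ] Coord n) -
      LinearMap.trace ℝ (Coord n) (B.comp (D y) : Coord n →ₗ[ℝ] Coord n) := by
    set L := fderiv ℝ (G.coeff e x) y
    set L' := fderiv ℝ (G.coeff e' (τ x)) (A y)
    have h1 : L'.comp A = A.comp L - D y := by ext1 w; exact hcoef w
    have h2 : (B.comp (L'.comp A)) = L - B.comp (D y) := by
      rw [h1, ContinuousLinearMap.comp_sub, ← ContinuousLinearMap.comp_assoc, hBA,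
        ContinuousLinearMap.id_comp]
    have h3 : LinearMap.trace ℝ (Coord n) (B.comp (L'.comp A) : Coord n →ₗ[ℝ] Coord n) =
        LinearMap.trace ℝ (Coord n) (L' : Coord n →ₗ[ℝ] Coord n) := by
      rw [ContinuousLinearMap.toLinearMap_comp, LinearMap.trace_comp_comm',
        ← ContinuousLinearMap.toLinearMap_comp, ContinuousLinearMap.comp_assoc, hAB,
        ContinuousLinearMap.comp_id]
    rw [← h3, h2, ContinuousLinearMap.toLinearMap_sub, map_sub]
  -- the volume
  obtain ⟨hdet, ddet, hjac⟩ := fderiv_log_det dA B hAB y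
  have hlog : (fun z => Real.log (dV.coeff e z)) =ᶠ[𝓝 x] fun z =>
      Real.log (dV.coeff e' (τ z)) +
        Real.log (LinearMap.det (fderiv ℝ τ z : Coord n →ₗ[ℝ] Coord n)) := by
    have hdn : ∀ᶠ z in 𝓝 x, z ∈ e.target ∧ e.symm z ∈ e'.source :=
      (e.isOpen_inter_preimage_symm e'.open_source).mem_nhds ⟨hx, hx'⟩
    filter_upwards [hdn] with z hz
    have h1 := dV.coeff_transform he he' hz.1 hz.2
    have h0 := dV.coeff_ne_zero he hz.1
    rw [h1] at h0
    rw [h1, Real.log_mul (left_ne_zero_of_mul h0) (right_ne_zero_of_mul h0), Real.log_abs]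
  have hvol : fderiv ℝ (fun z => Real.log (dV.coeff e z)) x y =
      fderiv ℝ (fun z => Real.log (dV.coeff e' z)) (τ x) (A y) +
        LinearMap.trace ℝ (Coord n) (B.comp (D y) : Coord n →ₗ[ℝ] Coord n) := by
    have h1 : HasFDerivAt (fun z => Real.log (dV.coeff e' (τ z)))
        ((fderiv ℝ (fun z => Real.log (dV.coeff e' z)) (τ x)).comp A) x :=
      HasFDerivAt.comp x (f := τ) (g := fun z => Real.log (dV.coeff e' z)) dl.hasFDerivAt
        (hcd.differentiableAt (by simp)).hasFDerivAt
    have h2 : fderiv ℝ (fun z => Real.log (dV.coeff e' (τ z)) +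
        Real.log (LinearMap.det (fderiv ℝ τ z : Coord n →ₗ[ℝ] Coord n))) x = _ :=
      (h1.add ddet.hasFDerivAt).fderiv
    rw [hlog.fderiv_eq, h2, add_apply, hjac]
    rfl
  rw [localS_eq dG, localS_eq dG', htr, hvol]
  ring

/-- The S-curvature is computed by the local formula in every chart. -/
theorem Spray.sCurvature_eq (G : Spray n M) (dV : VolumeForm n M)
    {e : OpenPartialHomeomorph M (Coord n)} (he : e ∈ 𝓜) {x y : Coord n} (hx : x ∈ e.target)
    (hy : y ≠ 0) :
    G.sCurvature dV (coordVec e x y) = localS (G.coeff e) (dV.coeff e) x y := by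
  have hc : chartAt (Coord n) (e.symm x) ∈ 𝓜 := IsManifold.chart_mem_maximalAtlas _
  have hs : e.symm x ∈ (chartAt (Coord n) (e.symm x)).source := mem_chart_source _ _
  rw [← G.localS_transform dV he hc hx hs hy]
  unfold sCurvature
  change localS (G.coeff (chartAt (Coord n) (e.symm x))) (dV.coeff (chartAt (Coord n) (e.symm x)))
    (tangentCoord (chartAt (Coord n) (e.symm x)) (coordVec e x y)).1
    (tangentCoord (chartAt (Coord n) (e.symm x)) (coordVec e x y)).2 = _
  rw [tangentCoord_coordVec he hc hx hs]

theorem fieldComp_liouville {e : OpenPartialHomeomorph M (Coord n)} (he : e ∈ 𝓜) {x : Coord n}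
    (hx : x ∈ e.target) (y : Coord n) :
    (mfderiv (𝓡 n).tangent 𝓘(ℝ, Coord n × Coord n) (tangentCoord e) (coordVec e x y)
      (liouville (coordVec e x y)) : Coord n × Coord n) = (0, y) := by
  set v := coordVec e x y with hv
  have hvs : v.proj ∈ e.source := e.map_target hx
  have hxy : tangentCoord e v = (x, y) := tangentCoord_coordVec_self he hx y
  set γ : ℝ → TangentBundle (𝓡 n) M := fun t => ⟨v.proj, t • v.2⟩ with hγ
  have hγ1 : γ 1 = v := by simp [hγ]
  have hγd : MDifferentiableAt 𝓘(ℝ, ℝ) (𝓡 n).tangent γ 1 := by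
    have h : ContMDiffAt 𝓘(ℝ, ℝ) (𝓡 n).tangent 1 γ 1 := by
      rw [Bundle.contMDiffAt_totalSpace]
      refine ⟨contMDiffAt_const, ?_⟩
      have hfun : (fun t : ℝ => (trivializationAt (Coord n) (TangentSpace (𝓡 n)) (γ 1).proj (γ t)).2)
          = fun t : ℝ => t • (trivializationAt (Coord n) (TangentSpace (𝓡 n)) v.proj v).2 := by
        funext t
        have hb : v.proj ∈ (trivializationAt (Coord n) (TangentSpace (𝓡 n) (M := M)) v.proj).baseSet :=
          FiberBundle.mem_baseSet_trivializationAt' v.proj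
        exact ((trivializationAt (Coord n) (TangentSpace (𝓡 n) (M := M)) v.proj).linear ℝ hb).map_smul
          t v.2
      rw [hfun, contMDiffAt_iff_contDiffAt]
      fun_prop
    exact h.mdifferentiableAt (by simp)
  have hcomp : (tangentCoord e ∘ γ) = fun t : ℝ => (x, t • y) := by
    funext t
    have h1 : (e v.proj, (mfderiv (𝓡 n) (𝓡 n) e v.proj v.2 : Coord n)) = (x, y) := hxy
    have h2 := congrArg Prod.fst h1
    have h3 := congrArg Prod.snd h1
    refine Prod.ext h2 ?_
    change (mfderiv (𝓡 n) (𝓡 n) e v.proj (t • v.2) : Coord n) = t • y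
    exact ((mfderiv (𝓡 n) (𝓡 n) e v.proj).map_smul t v.2).trans (congrArg (fun w : Coord n => t • w) h3)
  have hd : HasFDerivAt (fun t : ℝ => (x, t • y))
      ((0 : ℝ →L[ℝ] Coord n).prod ((ContinuousLinearMap.id ℝ ℝ).smulRight y)) 1 :=
    (hasFDerivAt_const x (1 : ℝ)).prodMk ((hasFDerivAt_id (𝕜 := ℝ) (1 : ℝ)).smul_const y)
  have htc : MDifferentiableAt (𝓡 n).tangent 𝓘(ℝ, Coord n × Coord n) (tangentCoord e) (γ 1) := by
    rw [hγ1]; exact mdiff_tangentCoord he hvs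
  have hc := mfderiv_comp (1 : ℝ) htc hγd
  rw [hcomp, mfderiv_eq_fderiv, hd.fderiv] at hc
  have h4 := congrArg (fun L : ℝ →L[ℝ] Coord n × Coord n => L 1) hc
  have h5 : ((0 : Coord n), y) = (mfderiv (𝓡 n).tangent 𝓘(ℝ, Coord n × Coord n) (tangentCoord e) (γ 1)
      (mfderiv 𝓘(ℝ, ℝ) (𝓡 n).tangent γ 1 (1 : ℝ)) : Coord n × Coord n) := by
    refine Eq.trans ?_ h4
    simp
  have key : ∀ (w : TangentBundle (𝓡 n) M) (ζ : Coord n × Coord n), w = v →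
      (mfderiv (𝓡 n).tangent 𝓘(ℝ, Coord n × Coord n) (tangentCoord e) w ζ : Coord n × Coord n) =
      mfderiv (𝓡 n).tangent 𝓘(ℝ, Coord n × Coord n) (tangentCoord e) v ζ := by
    rintro w ζ rfl; rfl
  exact ((h5.trans (key (γ 1) _ hγ1))).symm

theorem fderiv_coeff_smul (G : Spray n M) {e : OpenPartialHomeomorph M (Coord n)} (he : e ∈ 𝓜)
    {x y : Coord n} (hx : x ∈ e.target) (hy : y ≠ 0) {c : ℝ} (hc : 0 < c) :
    fderiv ℝ (G.coeff e x) (c • y) = c • fderiv ℝ (G.coeff e x) y := by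
  have d1 := G.differentiableAt_coeff he hx hy
  have d2 := G.differentiableAt_coeff he hx (smul_ne_zero hc.ne' hy)
  have hfun : (fun z : Coord n => G.coeff e x (c • z)) = fun z => c ^ 2 • G.coeff e x z :=
    funext fun z => G.homog e he x hx z c hc
  have h1 : HasFDerivAt (fun z : Coord n => G.coeff e x (c • z))
      ((fderiv ℝ (G.coeff e x) (c • y)).comp (c • ContinuousLinearMap.id ℝ (Coord n))) y :=
    HasFDerivAt.comp y (f := fun z : Coord n => c • z) d2.hasFDerivAt
      ((hasFDerivAt_id y).const_smul c)
  rw [hfun] at h1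
  have h2 := h1.unique (d1.hasFDerivAt.const_smul (c ^ 2))
  ext1 w
  have h3 := congrArg (fun L : Coord n →L[ℝ] Coord n => L w) h2
  simp only [ContinuousLinearMap.comp_apply, smul_apply, map_smul,
    ContinuousLinearMap.id_apply] at h3 ⊢
  refine smul_right_injective _ hc.ne' ?_
  beta_reduce
  rw [h3, smul_smul, pow_two]

theorem Spray.localS_smul (G : Spray n M) (dV : VolumeForm n M)
    {e : OpenPartialHomeomorph M (Coord n)} (he : e ∈ 𝓜) {x y : Coord n} (hx : x ∈ e.target)
    (hy : y ≠ 0) {c : ℝ} (hc : 0 < c) :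
    localS (G.coeff e) (dV.coeff e) x (c • y) = c * localS (G.coeff e) (dV.coeff e) x y := by
  rw [localS_eq (G.differentiableAt_coeff he hx (smul_ne_zero hc.ne' hy)),
    localS_eq (G.differentiableAt_coeff he hx hy), fderiv_coeff_smul G he hx hy hc,
    ContinuousLinearMap.toLinearMap_smul, map_smul, map_smul]
  simp only [smul_eq_mul]
  ring

theorem Spray.contDiffOn_localS (G : Spray n M) (dV : VolumeForm n M)
    {e : OpenPartialHomeomorph M (Coord n)} (he : e ∈ 𝓜) :
    ContDiffOn ℝ ∞ (fun z : Coord n × Coord n => localS (G.coeff e) (dV.coeff e) z.1 z.2)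
      (e.target ×ˢ {y | y ≠ 0}) := by
  set F : Coord n × Coord n → Coord n := fun z => G.coeff e z.1 z.2 with hF
  have hFs : ContDiffOn ℝ ∞ F (e.target ×ˢ {y | y ≠ 0}) := G.smooth e he
  have hF' : ContDiffOn ℝ ∞ (fderiv ℝ F) (e.target ×ˢ {y | y ≠ 0}) :=
    hFs.fderiv_of_isOpen isOpen_slit le_rfl
  have hl' : ContDiffOn ℝ ∞ (fderiv ℝ (fun x => Real.log (dV.coeff e x))) e.target :=
    (dV.contDiffOn_log he).fderiv_of_isOpen e.open_target le_rfl
  have h1 : ContDiffOn ℝ ∞ (fun z : Coord n × Coord n =>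
      (∑ m, (fderiv ℝ F z (0, stdVec m)) m) -
        fderiv ℝ (fun x => Real.log (dV.coeff e x)) z.1 z.2) (e.target ×ˢ {y | y ≠ 0}) := by
    refine ContDiffOn.sub (ContDiffOn.sum fun m _ => ?_) ?_
    · exact (EuclideanSpace.proj m : Coord n →L[ℝ] ℝ).contDiff.comp_contDiffOn
        (hF'.clm_apply contDiffOn_const)
    · exact (hl'.comp contDiffOn_fst fun z hz => hz.1).clm_apply contDiffOn_snd
  refine h1.congr fun z hz => ?_
  obtain ⟨x, y⟩ := z
  have dG := G.differentiableAt_coeff he hz.1 hz.2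
  have dF : DifferentiableAt ℝ F (x, y) :=
    (hFs.contDiffAt (isOpen_slit.mem_nhds hz)).differentiableAt (by simp)
  rw [localS_eq dG]
  congr 1
  rw [LinearMap.trace_eq_sum_inner _ (EuclideanSpace.basisFun (Fin n) ℝ)]
  refine Finset.sum_congr rfl fun m _ => ?_
  have h2 : HasFDerivAt (G.coeff e x)
      ((fderiv ℝ F (x, y)).comp (ContinuousLinearMap.inr ℝ (Coord n) (Coord n))) y :=
    HasFDerivAt.comp y (g := F) (f := fun y => (x, y)) dF.hasFDerivAt (hasFDerivAt_prodMk_right x y)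
  rw [h2.fderiv]
  simp [EuclideanSpace.inner_single_left]

/-- The vector field `Ĝ = G + (2 S / (n + 1)) · y^i ∂/∂y^i` on `TM`; in coordinates it has the
coefficients `Ĝ^i = G^i - S y^i / (n + 1)` (see `Spray.associated_coeff`). -/
def Spray.associatedField (G : Spray n M) (dV : VolumeForm n M) (v : TangentBundle (𝓡 n) M) :
    TangentSpace (𝓡 n).tangent v :=
  G.toFun v + (2 * (G.sCurvature dV v / ((n : ℝ) + 1))) • liouville v

theorem Spray.fieldComp_associatedField (G : Spray n M) (dV : VolumeForm n M)
    {e : OpenPartialHomeomorph M (Coord n)} (he : e ∈ 𝓜) {x : Coord n} (hx : x ∈ e.target)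
    (y : Coord n) :
    fieldComp (G.associatedField dV) e x y = fieldComp G.toFun e x y +
      (2 * (G.sCurvature dV (coordVec e x y) / ((n : ℝ) + 1))) • ((0 : Coord n), y) := by
  rw [← fieldComp_liouville he hx y]
  unfold fieldComp associatedField
  exact ((mfderiv (𝓡 n).tangent 𝓘(ℝ, Coord n × Coord n) (tangentCoord e)
    (coordVec e x y)).map_add _ _).trans (congrArg _ (ContinuousLinearMap.map_smul _ _ _))

theorem Spray.fieldCoeff_associatedField (G : Spray n M) (dV : VolumeForm n M)
    {e : OpenPartialHomeomorph M (Coord n)} (he : e ∈ 𝓜) {x : Coord n} (hx : x ∈ e.target)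
    (y : Coord n) :
    fieldCoeff (G.associatedField dV) e x y = G.coeff e x y -
      (localS (G.coeff e) (dV.coeff e) x y / ((n : ℝ) + 1)) • y := by
  have h1 : fieldCoeff (G.associatedField dV) e x y = G.coeff e x y -
      (G.sCurvature dV (coordVec e x y) / ((n : ℝ) + 1)) • y := by
    unfold coeff fieldCoeff
    rw [G.fieldComp_associatedField dV he hx y]
    simp only [Prod.snd_add, Prod.smul_snd, smul_add]
    module
  rw [h1]
  by_cases hy : y = 0
  · simp [hy]
  · rw [G.sCurvature_eq dV he hx hy]

/-- The spray `Ĝ` associated with `(G, dV)`. -/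
def Spray.associated (G : Spray n M) (dV : VolumeForm n M) : Spray n M where
  toFun := G.associatedField dV
  comp_fst e he x hx y := by
    rw [G.fieldComp_associatedField dV he hx y, Prod.fst_add, G.comp_fst e he x hx y]
    simp
  smooth e he := by
    have h1 : ContDiffOn ℝ ∞ (fun z : Coord n × Coord n => G.coeff e z.1 z.2 -
        (localS (G.coeff e) (dV.coeff e) z.1 z.2 / ((n : ℝ) + 1)) • z.2)
        (e.target ×ˢ {y | y ≠ 0}) :=
      (G.smooth e he).sub (((G.contDiffOn_localS dV he).div_const _).smul contDiffOn_snd)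
    exact h1.congr fun z hz => G.fieldCoeff_associatedField dV he hz.1 z.2
  homog e he x hx y c hc := by
    rw [G.fieldCoeff_associatedField dV he hx, G.fieldCoeff_associatedField dV he hx]
    have h0 : G.coeff e x (c • y) = c ^ 2 • G.coeff e x y := G.homog e he x hx y c hc
    rw [h0]
    by_cases hy : y = 0
    · simp [hy]
    · rw [G.localS_smul dV he hx hy hc, smul_sub, smul_smul, smul_smul]
      congr 2
      ring

/-- `Ĝ^i = G^i - S y^i / (n + 1)` in every chart. -/
theorem Spray.associated_coeff (G : Spray n M) (dV : VolumeForm n M)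
    {e : OpenPartialHomeomorph M (Coord n)} (he : e ∈ 𝓜) {x : Coord n} (hx : x ∈ e.target)
    (y : Coord n) :
    (G.associated dV).coeff e x y = G.coeff e x y -
      (localS (G.coeff e) (dV.coeff e) x y / ((n : ℝ) + 1)) • y :=
  G.fieldCoeff_associatedField dV he hx y

/-- A spray is of scalar curvature if, in local coordinates, `R^i_k = R δ^i_k - τ_k y^i` on nonzero
vectors, where `τ_k` is positively homogeneous of degree one in `y` and `τ_k y^k = R`. -/
def Spray.IsOfScalarCurvature (G : Spray n M) : Prop :=
  ∀ e ∈ IsManifold.maximalAtlas (𝓡 n) ∞ M, ∃ τ : Fin n → Coord n → Coord n → ℝ,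
    ∀ x ∈ e.target, ∀ y : Coord n, y ≠ 0 →
      (∀ k, ∀ c : ℝ, 0 < c → τ k x (c • y) = c * τ k x y) ∧
      (∑ k, τ k x y * y k = scalR (G.coeff e) x y) ∧
      ∀ i k, riemann2 (G.coeff e) i k x y =
        scalR (G.coeff e) x y * (if i = k then 1 else 0) - τ k x y * y i

/-- Two sprays are projectively equivalent if `G'^i = G^i + P y^i` on nonzero vectors, in local
coordinates, for a scalar function `P` on `TM`. -/
def Spray.ProjEquiv (G G' : Spray n M) : Prop :=
  ∃ P : TangentBundle (𝓡 n) M → ℝ, ∀ e ∈ IsManifold.maximalAtlas (𝓡 n) ∞ M, ∀ x ∈ e.target,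
    ∀ y : Coord n, y ≠ 0 → G'.coeff e x y = G.coeff e x y + P (coordVec e x y) • y

/-- The components `η_k` of the quantity `η` of a spray, in the chart `e`. -/
def Spray.eta (G : Spray n M) (e : OpenPartialHomeomorph M (Coord n)) (k : Fin n)
    (x y : Coord n) : ℝ :=
  localEta (G.coeff e) k x y

/-- The components of `η̂`, the quantity `η` of the spray `Ĝ` associated with `(G, dV)`. -/
def Spray.etaHat (G : Spray n M) (dV : VolumeForm n M) (e : OpenPartialHomeomorph M (Coord n))
    (k : Fin n) (x y : Coord n) : ℝ :=
  (G.associated dV).eta e k x y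

end Global

end SprayGeometry

end

/-! Write `Ĝ` for the associated spray, `R` for its curvature scalar, and `s_m = ∂ ln σ/∂x^m`.

Projective invariance already holds for `Ĝ` itself. Replacing `G^i` by `G^i + P y^i` changes `S` by
`(n + 1)P`, so `G^i - S y^i/(n + 1)` does not move (`assoc_add_mul_y`). This needs `P` to be
homogeneous of degree one, which the homogeneity of both sprays forces (`assoc_eq_of_projective`).

For the vanishing, the form `R^i_k = r δ^i_k - t_k y^i` survives any such projective change
(`riem2_add_mul_y`), so `Ĝ` has it too. Moreover `Ĝ` has zero S-curvature, hence `N^i_i = y^m s_m`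
with `s` closed, and the trace `R_i^i_{kl}` vanishes (`sum_dy_curv_eq_zero`). Comparing traces of
vertical derivatives of `R^i_k` then gives `t_k = ½ R_{·k}` (`two_mul_coeff`), so that `2 R^i_{kl} =
δ^i_k R_{·l} - δ^i_l R_{·k}` (`two_mul_curv`). For `n ≥ 3` the second Bianchi identity, as in
Schur's lemma, makes `R_{·l|m}` symmetric in `l` and `m` (`hor_dy_symm`). Contracting with `y^m` and
using Euler's identity `y^m R_{·m} = 2R` gives `R_{·l|m} y^m = 2 R_{|l}`, which is `η̂ = 0`.

Only commuting derivations, the elements `y^i` and division by `∑ y^i y^i` enter this argument. It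
is therefore carried out in an abstract differential algebra, `FibreCalculus`, and applied to the
smooth functions on the nonzero vectors over a chart. -/

noncomputable section

/-! ### Differential algebra of sprays: connections, curvature and Bianchi identities. -/

namespace SprayGeometry

/-- The differential algebra of functions of `(x, y)`: commuting derivations `∂/∂xᵏ`, `∂/∂yᵏ`,
the fibre coordinates `yᵏ`, and an inverse of `∑ yᵏ yᵏ`. -/
structure FibreCalculus (n : ℕ) (A : Type*) [CommRing A] [Algebra ℝ A] where
  dx : Fin n → Derivation ℝ A A
  dy : Fin n → Derivation ℝ A A
  y : Fin n → A
  sqInv : A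
  dx_dx : ∀ i j f, dx i (dx j f) = dx j (dx i f)
  dx_dy : ∀ i j f, dx i (dy j f) = dy j (dx i f)
  dy_dy : ∀ i j f, dy i (dy j f) = dy j (dy i f)
  dx_y : ∀ i j, dx i (y j) = 0
  dy_y : ∀ i j, dy j (y i) = if i = j then 1 else 0
  sqInv_mul : sqInv * ∑ i, y i * y i = 1

/-- The Kronecker symbol with values in a ring. -/
def kron (A : Type*) [CommRing A] {n : ℕ} (i j : Fin n) : A := if i = j then 1 else 0

section Kron

variable {n : ℕ} {A : Type*} [CommRing A] [Algebra ℝ A]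

theorem kron_self (i : Fin n) : kron A i i = 1 := by simp [kron]

theorem kron_of_ne {i j : Fin n} (h : i ≠ j) : kron A i j = 0 := by simp [kron, h]

@[simp] theorem derivation_kron (D : Derivation ℝ A A) (i j : Fin n) : D (kron A i j) = 0 := by
  unfold kron; split_ifs <;> simp

theorem sum_kron_mul (i : Fin n) (f : Fin n → A) : ∑ l, kron A i l * f l = f i := by
  simp [kron]

theorem sum_kron_mul' (i : Fin n) (f : Fin n → A) : ∑ l, kron A l i * f l = f i := by
  simp [kron]

end Kron

namespace FibreCalculus

variable {n : ℕ} {A : Type*} [CommRing A] [Algebra ℝ A] (C : FibreCalculus n A)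

theorem dy_y' (i j : Fin n) : C.dy j (C.y i) = kron A i j := C.dy_y i j

theorem sum_derivation_apply (a : Fin n → A) (D : Fin n → Derivation ℝ A A) (f : A) :
    (∑ m, a m • D m) f = ∑ m, a m * D m f := by
  rw [← Derivation.coeFnAddMonoidHom_apply, map_sum, Finset.sum_apply]
  rfl

/-- The `y^i` have no common zero: multiplying by `y^i`, summing and dividing by `∑ y^i y^i`
recovers the factor. It serves to pass from identities for `P y^i` or `t_k y^i` to identities for
`P` and `t_k`. -/
theorem eq_of_forall_mul_y {a b : A} (h : ∀ i, a * C.y i = b * C.y i) : a = b := by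
  have h1 : ∀ c : A, C.sqInv * ∑ i, c * C.y i * C.y i = c := fun c => by
    simp only [mul_assoc, ← Finset.mul_sum]
    rw [mul_left_comm, C.sqInv_mul, mul_one]
  rw [← h1 a, ← h1 b]
  simp only [h]

/-- `N^i_j`. -/
def N (G : Fin n → A) (i j : Fin n) : A := C.dy j (G i)

/-- `Γ^i_{jk}`. -/
def Γ (G : Fin n → A) (i j k : Fin n) : A := C.dy k (C.N G i j)

/-- The Euler derivation `y^m ∂/∂y^m`. -/
def euler : Derivation ℝ A A := ∑ m, C.y m • C.dy m

/-- The derivation `δ/δx^k`. -/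
def hor (G : Fin n → A) (k : Fin n) : Derivation ℝ A A := C.dx k - ∑ m, C.N G m k • C.dy m

/-- The curvature `R^i_{kl}` of the nonlinear connection. -/
def curv (G : Fin n → A) (i k l : Fin n) : A := C.hor G k (C.N G i l) - C.hor G l (C.N G i k)

/-- `R_j^i_{kl}`. -/
def riem (G : Fin n → A) (j i k l : Fin n) : A :=
  C.hor G k (C.Γ G i j l) - C.hor G l (C.Γ G i j k)
    + ∑ s, (C.Γ G i k s * C.Γ G s j l - C.Γ G s j k * C.Γ G i l s)

/-- `R^i_k`. -/
def riem2 (G : Fin n → A) (i k : Fin n) : A := ∑ j, ∑ l, C.y j * C.riem G j i k l * C.y l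

/-- The quantity `η_k` computed from a scalar `r` in place of `R`. -/
def eta (G : Fin n → A) (r : A) (k : Fin n) : A :=
  (1 / 2 : ℝ) • ∑ m, (C.hor G m (C.dy k r) - ∑ s, C.Γ G s k m * C.dy s r) * C.y m - C.hor G k r

theorem euler_apply (f : A) : C.euler f = ∑ m, C.y m * C.dy m f := by
  simp only [euler, sum_derivation_apply]

theorem hor_apply (G : Fin n → A) (k : Fin n) (f : A) :
    C.hor G k f = C.dx k f - ∑ m, C.N G m k * C.dy m f := by
  rw [hor, Derivation.sub_apply, sum_derivation_apply]

theorem Γ_symm (G : Fin n → A) (i j k : Fin n) : C.Γ G i j k = C.Γ G i k j := C.dy_dy _ _ _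

theorem dy_N (G : Fin n → A) (i j k : Fin n) : C.dy k (C.N G i j) = C.Γ G i j k := rfl

theorem hor_y (G : Fin n → A) (i k : Fin n) : C.hor G k (C.y i) = -C.N G i k := by
  simp [hor_apply, C.dx_y, C.dy_y]

theorem euler_y (i : Fin n) : C.euler (C.y i) = C.y i := by
  simp [euler_apply, C.dy_y]

theorem dy_euler (j : Fin n) (f : A) : C.dy j (C.euler f) = C.euler (C.dy j f) + C.dy j f := by
  simp only [euler_apply, map_sum, Derivation.leibniz, smul_eq_mul, Finset.sum_add_distrib,
    C.dy_y', C.dy_dy j]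
  congr 1
  simp only [mul_comm, sum_kron_mul']

/-- The commutator of a vertical and a horizontal derivation is vertical, because only the
coefficients `N^m_k` get differentiated; this is where `Γ` comes in. -/
theorem dy_hor (G : Fin n → A) (j k : Fin n) (f : A) :
    C.dy j (C.hor G k f) = C.hor G k (C.dy j f) - ∑ m, C.Γ G m k j * C.dy m f := by
  simp only [hor_apply, map_sub, map_sum, Derivation.leibniz, smul_eq_mul, Finset.sum_add_distrib,
    C.dx_dy, C.dy_N, C.dy_dy j]
  rw [sub_sub]
  congr 2
  exact Finset.sum_congr rfl fun i _ => mul_comm _ _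

/-- The horizontal derivations fail to commute only by a vertical one, with `R^i_{kl}` as
components. This commutator is the source of the second Bianchi identity. -/
theorem hor_hor_sub (G : Fin n → A) (k l : Fin n) (f : A) :
    C.hor G k (C.hor G l f) - C.hor G l (C.hor G k f) = -∑ i, C.curv G i k l * C.dy i f := by
  -- In this expansion every term except the last is symmetric in `k` and `l`; the last one
  -- antisymmetrises to the curvature.
  have h : ∀ k l, C.hor G k (C.hor G l f) = C.dx k (C.dx l f)
      - ∑ m, (C.N G m k * C.dy m (C.dx l f) + C.N G m l * C.dy m (C.dx k f))
      + ∑ m, ∑ p, C.N G m l * C.N G p k * C.dy p (C.dy m f)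
      - ∑ m, C.hor G k (C.N G m l) * C.dy m f := by
    intro k l
    rw [C.hor_apply G l f, map_sub, map_sum]
    simp only [Derivation.leibniz, smul_eq_mul, Finset.sum_add_distrib]
    simp only [C.hor_apply G k (C.dx l f), C.hor_apply G k (C.dy _ f), mul_sub,
      Finset.sum_sub_distrib, Finset.mul_sum, C.dx_dy]
    have e1 : ∀ m, C.dy m f * C.hor G k (C.N G m l) = C.hor G k (C.N G m l) * C.dy m f :=
      fun m => mul_comm _ _
    simp only [e1, mul_assoc]
    ring
  rw [h k l, h l k, C.dx_dx k l]
  have h2 : ∑ m, ∑ p, C.N G m l * C.N G p k * C.dy p (C.dy m f) =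
      ∑ m, ∑ p, C.N G m k * C.N G p l * C.dy p (C.dy m f) := by
    rw [Finset.sum_comm]
    refine Finset.sum_congr rfl fun m _ => Finset.sum_congr rfl fun p _ => ?_
    rw [C.dy_dy m p]; ring
  rw [h2]
  simp only [curv, sub_mul, Finset.sum_sub_distrib, Finset.sum_add_distrib]
  ring

theorem curv_antisymm (G : Fin n → A) (i k l : Fin n) : C.curv G i k l = -C.curv G i l k := by
  simp [curv]

/-- The second Bianchi identity. -/
theorem bianchi (G : Fin n → A) (i k l m : Fin n) :
    (C.hor G m (C.curv G i k l) + ∑ j, C.curv G j k l * C.Γ G i m j) +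
    (C.hor G k (C.curv G i l m) + ∑ j, C.curv G j l m * C.Γ G i k j) +
    (C.hor G l (C.curv G i m k) + ∑ j, C.curv G j m k * C.Γ G i l j) = 0 := by
  -- The cyclic sum of `δ_m(δ_k N_l - δ_l N_k)` regroups into commutators of two horizontal
  -- derivations applied to the third `N`.
  have h1 := C.hor_hor_sub G k l (C.N G i m)
  have h2 := C.hor_hor_sub G l m (C.N G i k)
  have h3 := C.hor_hor_sub G m k (C.N G i l)
  simp only [dy_N] at h1 h2 h3
  have e : ∀ a b c, C.hor G a (C.curv G i b c) =
      C.hor G a (C.hor G b (C.N G i c)) - C.hor G a (C.hor G c (C.N G i b)) :=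
    fun a b c => map_sub _ _ _
  rw [e, e, e]
  linear_combination h1 + h2 + h3

/-- Moving `∂/∂y^j` past the horizontal derivations in `R^i_{kl}` produces exactly the quadratic
terms in `Γ`. The full tensor is thus governed by `R^i_{kl}`. -/
theorem riem_eq_dy_curv (G : Fin n → A) (j i k l : Fin n) :
    C.riem G j i k l = C.dy j (C.curv G i k l) := by
  simp only [riem, curv, map_sub, dy_hor, dy_N, Finset.sum_sub_distrib]
  rw [C.Γ_symm G i j l, C.Γ_symm G i j k]
  have h1 : ∑ s, C.Γ G i k s * C.Γ G s j l = ∑ m, C.Γ G m l j * C.Γ G i k m :=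
    Finset.sum_congr rfl fun s _ => by rw [C.Γ_symm G s j l, mul_comm]
  have h2 : ∑ s, C.Γ G s j k * C.Γ G i l s = ∑ m, C.Γ G m k j * C.Γ G i l m :=
    Finset.sum_congr rfl fun s _ => by rw [C.Γ_symm G s j k]
  rw [h1, h2]
  ring

/-- The first Bianchi identity. -/
theorem riem_cyclic (G : Fin n → A) (j i k l : Fin n) :
    C.riem G j i k l + C.riem G k i l j + C.riem G l i j k = 0 := by
  simp only [riem, Finset.sum_sub_distrib]
  have h : ∀ a b c, ∑ s, C.Γ G s a b * C.Γ G i c s = ∑ s, C.Γ G i c s * C.Γ G s b a :=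
    fun a b c => Finset.sum_congr rfl fun s _ => by rw [C.Γ_symm G s a b, mul_comm]
  simp only [h, C.Γ_symm G i l k, C.Γ_symm G i j k, C.Γ_symm G i l j, C.Γ_symm G _ l k,
    C.Γ_symm G _ j k, C.Γ_symm G _ l j]
  ring

/-! ### Euler's identity for sprays of degree two. -/

section Homogeneous

variable {C} {G : Fin n → A} (hG : ∀ i, C.euler (G i) = 2 * G i)
include hG

theorem euler_N (i j : Fin n) : C.euler (C.N G i j) = C.N G i j := by
  have h := C.dy_euler j (G i)
  rw [hG, two_mul, map_add] at h
  exact (add_right_cancel h).symm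

/-- Since `N` has degree one, `y^p Γ^m_{kp} = N^m_k`, and the two corrections in the commutator with
the Euler derivation cancel. Horizontal derivation therefore preserves degree. -/
theorem euler_hor (k : Fin n) (f : A) : C.euler (C.hor G k f) = C.hor G k (C.euler f) := by
  have h := euler_N hG
  have h1 : ∀ m, ∑ p, C.y p * C.Γ G m k p = C.N G m k := fun m => by
    rw [← h m k, euler_apply]; rfl
  simp only [euler_apply C f, map_sum, Derivation.leibniz, smul_eq_mul, Finset.sum_add_distrib,
    hor_y]
  simp only [euler_apply, dy_hor, mul_sub, Finset.sum_sub_distrib, Finset.mul_sum]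
  rw [sub_eq_add_neg, Finset.sum_comm (γ := Fin n)]
  congr 1
  rw [← Finset.sum_neg_distrib]
  refine Finset.sum_congr rfl fun m _ => ?_
  simp only [← mul_assoc, ← Finset.sum_mul, h1]
  ring

theorem euler_curv (i k l : Fin n) : C.euler (C.curv G i k l) = C.curv G i k l := by
  simp only [curv, map_sub, euler_hor hG, euler_N hG]

theorem riem2_eq (i k : Fin n) : C.riem2 G i k = ∑ l, C.curv G i k l * C.y l := by
  unfold riem2
  rw [Finset.sum_comm]
  refine Finset.sum_congr rfl fun l _ => ?_
  rw [← Finset.sum_mul]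
  simp only [riem_eq_dy_curv, ← euler_apply, euler_curv hG]

theorem euler_riem2 (i k : Fin n) : C.euler (C.riem2 G i k) = 2 * C.riem2 G i k := by
  simp only [riem2_eq hG, map_sum, Derivation.leibniz, euler_curv hG, euler_y, Finset.mul_sum]
  exact Finset.sum_congr rfl fun l _ => by simp only [smul_eq_mul]; ring

/-- Differentiating `R^i_k = R^i_{kl} y^l` gives `R^i_{kl}` plus a contraction of the full tensor.
Antisymmetrising yields two copies of `R^i_{kl}` directly, and the first Bianchi identity turns the
contractions into a third. -/
theorem three_mul_curv (i k l : Fin n) :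
    3 * C.curv G i k l = C.dy l (C.riem2 G i k) - C.dy k (C.riem2 G i l) := by
  have h : ∀ k l, C.dy l (C.riem2 G i k) = ∑ j, C.y j * C.riem G l i k j + C.curv G i k l := by
    intro k l
    simp only [riem2_eq hG, map_sum, Derivation.leibniz, smul_eq_mul, dy_y', riem_eq_dy_curv,
      Finset.sum_add_distrib]
    rw [add_comm]
    congr 1
    rw [← sum_kron_mul' l (fun j => C.curv G i k j)]
    exact Finset.sum_congr rfl fun _ _ => mul_comm _ _
  rw [h k l, h l k]
  have h1 : ∑ j, C.y j * C.riem G l i k j - ∑ j, C.y j * C.riem G k i l j = C.curv G i k l := by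
    have h2 : C.curv G i k l = ∑ j, C.y j * C.riem G j i k l := by
      simp only [riem_eq_dy_curv, ← euler_apply, euler_curv hG]
    rw [h2, ← Finset.sum_sub_distrib]
    refine Finset.sum_congr rfl fun j _ => ?_
    have h3 := C.riem_cyclic G j i k l
    have h4 : C.riem G l i j k = -C.riem G l i k j := by
      simp only [riem_eq_dy_curv, C.curv_antisymm G i j k, map_neg]
    linear_combination C.y j * h4 - C.y j * h3
  linear_combination -h1 + C.curv_antisymm G i k l

end Homogeneous

end FibreCalculus

/-! ### Consequences of a vanishing curvature trace. -/

namespace FibreCalculus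

variable {n : ℕ} {A : Type*} [CommRing A] [Algebra ℝ A] {C : FibreCalculus n A}

theorem eq_of_natCast_mul_eq {m : ℕ} (hm : m ≠ 0) {a b : A} (h : (m : A) * a = m * b) : a = b := by
  have h1 : ∀ c : A, (m : ℝ)⁻¹ • ((m : A) * c) = c := fun c => by
    rw [← nsmul_eq_mul, ← Nat.cast_smul_eq_nsmul ℝ, smul_smul,
      inv_mul_cancel₀ (Nat.cast_ne_zero.2 hm), one_smul]
  rw [← h1 a, h, h1]

/-- The assumption on the trace of `N` gives `Γ^i_{il} = s_l`, a function of `x` alone. The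
quadratic terms of `R_i^i_{kl}` cancel in the trace, leaving `∂_k s_l - ∂_l s_k`, which is zero as
`s` is closed. -/
theorem sum_dy_curv_eq_zero {G : Fin n → A} (s : Fin n → A)
    (hN : ∑ i, C.N G i i = ∑ m, C.y m * s m) (hy : ∀ j m, C.dy j (s m) = 0)
    (hx : ∀ k m, C.dx k (s m) = C.dx m (s k)) (k l : Fin n) :
    ∑ i, C.dy i (C.curv G i k l) = 0 := by
  have hΓ : ∀ l, ∑ i, C.Γ G i i l = s l := fun l => by
    have h := congrArg (C.dy l) hN
    simp only [map_sum, Derivation.leibniz, hy, smul_eq_mul, mul_zero, zero_add, dy_y', dy_N] at h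
    rw [h, ← sum_kron_mul' l s]
    exact Finset.sum_congr rfl fun _ _ => mul_comm _ _
  have hh : ∀ k l, ∑ i, C.hor G k (C.Γ G i i l) = C.dx k (s l) := fun k l => by
    rw [← map_sum, hΓ, hor_apply]
    simp [hy]
  simp only [← riem_eq_dy_curv, riem, Finset.sum_add_distrib, Finset.sum_sub_distrib, hh]
  have h2 : ∑ i, ∑ s, C.Γ G s i k * C.Γ G i l s = ∑ i, ∑ s, C.Γ G i k s * C.Γ G s i l := by
    rw [Finset.sum_comm]
    refine Finset.sum_congr rfl fun m _ => Finset.sum_congr rfl fun p _ => ?_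
    rw [C.Γ_symm G m p k, C.Γ_symm G p l m]
  rw [h2, hx k l]
  ring

/-! ### Curvature of the form `r δ^i_k - t_k y^i`. -/

section Isotropic

variable {G : Fin n → A} {r : A} {t : Fin n → A}

theorem sum_riem2_mul_y (hG : ∀ i, C.euler (G i) = 2 * G i) (i : Fin n) :
    ∑ k, C.riem2 G i k * C.y k = 0 := by
  have h : ∑ k, C.riem2 G i k * C.y k = -∑ k, C.riem2 G i k * C.y k := by
    simp only [riem2_eq hG, Finset.sum_mul]
    conv_rhs => rw [Finset.sum_comm]
    simp only [← Finset.sum_neg_distrib]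
    refine Finset.sum_congr rfl fun m _ => Finset.sum_congr rfl fun p _ => ?_
    rw [C.curv_antisymm G i m p]
    ring
  refine eq_of_natCast_mul_eq two_ne_zero ?_
  push_cast
  linear_combination h

/-- Antisymmetry of the curvature gives `R^i_k y^k = 0`, that is `(r - t_k y^k) y^i = 0`. The
relation thus comes for free for the new `r` and `t` after a projective change. -/
theorem sum_mul_y_eq (hG : ∀ i, C.euler (G i) = 2 * G i)
    (hR : ∀ i k, C.riem2 G i k = r * kron A i k - t k * C.y i) : ∑ k, C.y k * t k = r := by
  refine C.eq_of_forall_mul_y fun i => ?_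
  have h := C.sum_riem2_mul_y hG i
  simp only [hR, sub_mul, mul_assoc, Finset.sum_sub_distrib, ← Finset.mul_sum,
    sum_kron_mul] at h
  have h2 : ∑ k, t k * (C.y i * C.y k) = (∑ k, C.y k * t k) * C.y i := by
    rw [Finset.sum_mul]
    exact Finset.sum_congr rfl fun _ _ => by ring
  linear_combination -h - h2

theorem trace_riem2 (hG : ∀ i, C.euler (G i) = 2 * G i)
    (hR : ∀ i k, C.riem2 G i k = r * kron A i k - t k * C.y i) :
    ∑ i, C.riem2 G i i = ((n : A) - 1) * r := by
  have h := sum_mul_y_eq hG hR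
  simp only [hR, kron_self, Finset.sum_sub_distrib, mul_comm (t _), h]
  simp
  ring

/-- The trace `(n - 1) r` has degree two, hence so has `r`, hence so has `t_k y^i`. -/
theorem euler_coeff (hn : 2 ≤ n) (hG : ∀ i, C.euler (G i) = 2 * G i)
    (hR : ∀ i k, C.riem2 G i k = r * kron A i k - t k * C.y i) (k : Fin n) :
    C.euler (t k) = t k := by
  -- The factor `n - 1` becomes the natural number `m`, nonzero because `n ≥ 2`, and can be
  -- cancelled.
  obtain ⟨m, rfl⟩ : ∃ m, n = m + 1 := ⟨n - 1, by omega⟩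
  have hr : C.euler r = 2 * r := by
    have h := trace_riem2 hG hR
    have h2 := congrArg C.euler h
    rw [map_sum] at h2
    simp only [euler_riem2 hG, ← Finset.mul_sum] at h2
    rw [h] at h2
    refine eq_of_natCast_mul_eq (show m ≠ 0 by omega) ?_
    simp only [Derivation.leibniz, map_sub, smul_eq_mul, Derivation.map_natCast,
      Derivation.map_one_eq_zero] at h2
    push_cast at h2
    linear_combination -h2
  refine C.eq_of_forall_mul_y fun i => ?_
  have h := C.euler_riem2 hG i k
  rw [hR] at h
  simp only [map_sub, Derivation.leibniz, smul_eq_mul, derivation_kron, hr, euler_y] at h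
  linear_combination -h

/-- Let `D = ∂_i R^i_k` and `T = ∂_k R^i_i`. The vanishing trace gives `D = R^i_{ki}`, while
`three_mul_curv` gives `3 R^i_{ki} = D - T`; hence `2D = -T`. For the isotropic form `D = r_{·k} -
(n + 1) t_k` and `T = (n - 1) r_{·k}`, so `(n + 1) r_{·k} = 2(n + 1) t_k`. -/
theorem two_mul_coeff (hn : 2 ≤ n) (hG : ∀ i, C.euler (G i) = 2 * G i)
    (hR : ∀ i k, C.riem2 G i k = r * kron A i k - t k * C.y i)
    (hS : ∀ k l, ∑ i, C.dy i (C.curv G i k l) = 0) (k : Fin n) : 2 * t k = C.dy k r := by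
  have hE := euler_coeff hn hG hR k
  have hty := congrArg (C.dy k) (sum_mul_y_eq hG hR)
  simp only [map_sum, Derivation.leibniz, smul_eq_mul, dy_y', Finset.sum_add_distrib,
    mul_comm (t _), sum_kron_mul'] at hty
  have hd : ∀ i k l, C.dy l (C.riem2 G i k) =
      kron A i k * C.dy l r - (kron A i l * t k + C.y i * C.dy l (t k)) := by
    intro i k l
    rw [hR]
    simp only [map_sub, Derivation.leibniz, smul_eq_mul, derivation_kron, dy_y']
    ring
  have hdiv : ∑ i, C.dy i (C.riem2 G i k) = C.dy k r - (n * t k + t k) := by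
    simp only [hd, Finset.sum_sub_distrib, Finset.sum_add_distrib, ← euler_apply, hE,
      sum_kron_mul', kron_self]
    simp
  have htr : ∑ i, C.dy k (C.riem2 G i i) = n * C.dy k r - (t k + (C.dy k r - t k)) := by
    have h : ∑ i, kron A i k * t i = t k := sum_kron_mul' _ _
    simp only [hd, Finset.sum_sub_distrib, Finset.sum_add_distrib, kron_self, h]
    simp only [one_mul, Finset.sum_const, Finset.card_univ, Fintype.card_fin, nsmul_eq_mul]
    linear_combination -hty
  have h1 : ∑ i, C.dy i (C.riem2 G i k) = ∑ i, C.curv G i k i := by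
    simp only [riem2_eq hG, map_sum, Derivation.leibniz, smul_eq_mul, dy_y',
      Finset.sum_add_distrib]
    rw [Finset.sum_comm (γ := Fin n) (f := fun i l => C.y l * C.dy i (C.curv G i k l))]
    simp only [← Finset.mul_sum, hS, mul_zero, Finset.sum_const_zero, add_zero]
    exact Finset.sum_congr rfl fun i _ => by
      rw [← sum_kron_mul' i (fun j => C.curv G i k j)]
      exact Finset.sum_congr rfl fun _ _ => mul_comm _ _
  have h3 : 3 * ∑ i, C.curv G i k i =
      ∑ i, C.dy i (C.riem2 G i k) - ∑ i, C.dy k (C.riem2 G i i) := by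
    rw [Finset.mul_sum, ← Finset.sum_sub_distrib]
    exact Finset.sum_congr rfl fun i _ => three_mul_curv hG i k i
  refine eq_of_natCast_mul_eq n.succ_ne_zero ?_
  push_cast
  linear_combination 2 * hdiv + htr - h3 - 3 * h1

/-- With `t_k = ½ r_{·k}` the terms of `three_mul_curv` along `y^i` involve the vertical Hessian of
`r`, which is symmetric, and they cancel. -/
theorem two_mul_curv (hn : 2 ≤ n) (hG : ∀ i, C.euler (G i) = 2 * G i)
    (hR : ∀ i k, C.riem2 G i k = r * kron A i k - t k * C.y i)
    (hS : ∀ k l, ∑ i, C.dy i (C.curv G i k l) = 0) (i k l : Fin n) :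
    2 * C.curv G i k l = kron A i k * C.dy l r - kron A i l * C.dy k r := by
  have ht := two_mul_coeff hn hG hR hS
  have h := three_mul_curv hG i k l
  simp only [hR, map_sub, Derivation.leibniz, smul_eq_mul, derivation_kron, dy_y'] at h
  have h2 : ∀ k l, 2 * C.dy l (t k) = C.dy l (C.dy k r) := fun k l => by
    rw [← ht k, two_mul, two_mul, map_add]
  refine eq_of_natCast_mul_eq three_ne_zero ?_
  push_cast
  linear_combination 2 * h - C.y i * h2 k l + C.y i * h2 l k + kron A i k * ht l - kron A i l * ht k
    + C.y i * C.dy_dy k l r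

/-- This is the Schur-type step: the second Bianchi identity is read off in a component whose upper
index equals one lower index and differs from the other two. -/
theorem hor_dy_symm (hn : 3 ≤ n)
    (hK : ∀ i k l, 2 * C.curv G i k l = kron A i k * C.dy l r - kron A i l * C.dy k r)
    (l m : Fin n) : C.hor G m (C.dy l r) = C.hor G l (C.dy m r) := by
  rcases eq_or_ne l m with rfl | hlm
  · rfl
  -- A third index exists because `n ≥ 3`.
  obtain ⟨k, hk⟩ : ∃ k, k ∉ ({l, m} : Finset (Fin n)) := by
    by_contra! h
    have h1 := Finset.card_le_card (fun k _ => h k : (Finset.univ : Finset (Fin n)) ⊆ {l, m})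
    have h2 := Finset.card_le_two (a := l) (b := m)
    simp at h1
    omega
  simp only [Finset.mem_insert, Finset.mem_singleton, not_or] at hk
  have hh : ∀ a b c, 2 * C.hor G a (C.curv G k b c) =
      kron A k b * C.hor G a (C.dy c r) - kron A k c * C.hor G a (C.dy b r) := fun a b c => by
    have h := congrArg (C.hor G a) (hK k b c)
    rw [two_mul, map_add, ← two_mul] at h
    simp only [map_sub, Derivation.leibniz, smul_eq_mul, derivation_kron] at h
    linear_combination h
  have hΓ : ∀ a b c, 2 * ∑ j, C.curv G j b c * C.Γ G k a j =
      C.Γ G k a b * C.dy c r - C.Γ G k a c * C.dy b r := fun a b c => by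
    simp only [Finset.mul_sum, ← mul_assoc, hK, sub_mul, Finset.sum_sub_distrib]
    simp only [mul_assoc, sum_kron_mul']
    ring
  -- With upper index `k`, the Kronecker symbols leave only `δ_m r_{·l}` and `δ_l r_{·m}`; the `Γ`
  -- terms cancel by symmetry of `Γ`.
  have hB := C.bianchi G k k l m
  have e1 := hh m k l
  have e2 := hh k l m
  have e3 := hh l m k
  simp only [kron_self, kron_of_ne hk.1, kron_of_ne hk.2] at e1 e2 e3
  linear_combination 2 * hB - e1 - e2 - e3 - hΓ m k l - hΓ k l m - hΓ l m k
    - C.dy l r * C.Γ_symm G k m k - C.dy m r * C.Γ_symm G k k l - C.dy k r * C.Γ_symm G k l m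

/-- By the symmetry of `r_{·l|m}`, the contraction `r_{·l|m} y^m` equals `(y^m r_{·m})_{|l}`, and
`y^m r_{·m} = 2r` because `2 t_m = r_{·m}`. In the computation the terms `N^m_l r_{·m}` come once
from `δ y^m/δx^l` and once from `y^m Γ^s_{lm}`, and cancel. -/
theorem eta_eq_zero_of_isotropic (hn : 3 ≤ n) (hG : ∀ i, C.euler (G i) = 2 * G i)
    (hR : ∀ i k, C.riem2 G i k = r * kron A i k - t k * C.y i)
    (hS : ∀ k l, ∑ i, C.dy i (C.curv G i k l) = 0) (l : Fin n) : C.eta G r l = 0 := by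
  have hn2 : 2 ≤ n := by omega
  have ht := two_mul_coeff hn2 hG hR hS
  have hsym := hor_dy_symm hn (two_mul_curv hn2 hG hR hS)
  have hy : ∑ m, C.y m * C.dy m r = 2 * r := by
    simp only [← ht]
    conv_rhs => rw [← sum_mul_y_eq hG hR, Finset.mul_sum]
    exact Finset.sum_congr rfl fun _ _ => by ring
  have h1 : ∑ m, C.hor G m (C.dy l r) * C.y m = 2 * C.hor G l r + ∑ m, C.N G m l * C.dy m r := by
    have h := congrArg (C.hor G l) hy
    rw [two_mul, map_add, ← two_mul] at h
    simp only [map_sum, Derivation.leibniz, smul_eq_mul, Finset.sum_add_distrib, hor_y] at h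
    rw [← h]
    simp only [fun m => hsym l m, mul_comm (C.y _), mul_comm (C.dy _ r), neg_mul,
      Finset.sum_neg_distrib]
    ring
  have h2 : ∑ m, (∑ s, C.Γ G s l m * C.dy s r) * C.y m = ∑ m, C.N G m l * C.dy m r := by
    simp only [Finset.sum_mul]
    rw [Finset.sum_comm]
    refine Finset.sum_congr rfl fun s _ => ?_
    rw [← euler_N hG s l, euler_apply, Finset.sum_mul]
    exact Finset.sum_congr rfl fun m _ => by rw [dy_N]; ring
  unfold eta
  simp only [sub_mul, Finset.sum_sub_distrib, h1, h2]
  rw [add_sub_cancel_right, two_mul, smul_add, ← add_smul]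
  norm_num

end Isotropic

/-! ### Projective change of a spray. -/

section Projective

variable {G : Fin n → A} {P : A}

theorem euler_dy_of_euler (hP : C.euler P = P) (k : Fin n) : C.euler (C.dy k P) = 0 := by
  have h := C.dy_euler k P
  rw [hP] at h
  linear_combination -h

theorem euler_add_mul_y (hG : ∀ i, C.euler (G i) = 2 * G i) (hP : C.euler P = P) (i : Fin n) :
    C.euler (G i + P * C.y i) = 2 * (G i + P * C.y i) := by
  simp only [map_add, hG, Derivation.leibniz, hP, euler_y, smul_eq_mul]
  ring

theorem N_add_mul_y (i j : Fin n) :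
    C.N (fun i => G i + P * C.y i) i j = C.N G i j + P * kron A i j + C.dy j P * C.y i := by
  simp only [N, map_add, Derivation.leibniz, smul_eq_mul, dy_y']
  ring

theorem hor_add_mul_y (k : Fin n) (f : A) :
    C.hor (fun i => G i + P * C.y i) k f = C.hor G k f - P * C.dy k f - C.dy k P * C.euler f := by
  simp only [hor_apply, N_add_mul_y, add_mul, Finset.sum_add_distrib, euler_apply, Finset.mul_sum]
  have h : ∑ m, P * kron A m k * C.dy m f = P * C.dy k f := by
    simp only [mul_assoc, ← Finset.mul_sum, sum_kron_mul']
  simp only [mul_assoc] at *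
  rw [h]
  ring

theorem curv_add_mul_y (hG : ∀ i, C.euler (G i) = 2 * G i) (hP : C.euler P = P) (i k l : Fin n) :
    C.curv (fun i => G i + P * C.y i) i k l = C.curv G i k l
      + (C.hor G k P - P * C.dy k P) * kron A i l - (C.hor G l P - P * C.dy l P) * kron A i k
      + (C.hor G k (C.dy l P) - C.hor G l (C.dy k P)) * C.y i := by
  simp only [curv, hor_add_mul_y, N_add_mul_y, map_add, Derivation.leibniz, smul_eq_mul,
    derivation_kron, euler_N hG, hP, euler_dy_of_euler hP, hor_y, dy_N]
  rw [C.Γ_symm G i k l, C.dy_dy k l P]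
  ring

/-- Every correction to `R^i_{kl}` is proportional to a Kronecker symbol or to `y^i`, so contraction
with `y^l` keeps the isotropic shape. In this sense scalar curvature is a projective property. -/
theorem riem2_add_mul_y (hG : ∀ i, C.euler (G i) = 2 * G i) (hP : C.euler P = P) {r : A}
    {t : Fin n → A} (hR : ∀ i k, C.riem2 G i k = r * kron A i k - t k * C.y i) (i k : Fin n) :
    C.riem2 (fun i => G i + P * C.y i) i k =
      (r - ∑ l, (C.hor G l P - P * C.dy l P) * C.y l) * kron A i k -
      (t k - (C.hor G k P - P * C.dy k P)
        - ∑ l, (C.hor G k (C.dy l P) - C.hor G l (C.dy k P)) * C.y l) * C.y i := by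
  have h := hR i k
  rw [riem2_eq hG] at h
  rw [riem2_eq (euler_add_mul_y hG hP)]
  simp only [curv_add_mul_y hG hP]
  -- Only the shape of the correction matters, so the contraction is done for arbitrary
  -- coefficients.
  have key : ∀ a b : Fin n → A,
      ∑ l, (C.curv G i k l + a k * kron A i l - a l * kron A i k + b l * C.y i) * C.y l =
        (r - ∑ l, a l * C.y l) * kron A i k - (t k - a k - ∑ l, b l * C.y l) * C.y i := by
    intro a b
    have h1 : ∑ l, a k * kron A i l * C.y l = a k * C.y i := by
      simp only [mul_assoc, ← Finset.mul_sum, sum_kron_mul]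
    have h2 : ∀ c : A, ∀ f : Fin n → A, ∑ l, f l * c * C.y l = (∑ l, f l * C.y l) * c :=
      fun c f => by
        rw [Finset.sum_mul]
        exact Finset.sum_congr rfl fun l _ => mul_right_comm _ _ _
    simp only [add_mul, sub_mul, Finset.sum_add_distrib, Finset.sum_sub_distrib, h, h1, h2]
    ring
  exact key (fun k => C.hor G k P - P * C.dy k P)
    fun l => C.hor G k (C.dy l P) - C.hor G l (C.dy k P)

end Projective

/-! ### S-curvature and the associated spray. -/

section SCurvature

/-- The S-curvature, in terms of the gradient `s` of `ln σ`. -/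
def sCurv (C : FibreCalculus n A) (G s : Fin n → A) : A := ∑ m, C.N G m m - ∑ m, C.y m * s m

/-- The spray coefficients `G^i - S / (n + 1) y^i`. -/
def assoc (C : FibreCalculus n A) (G s : Fin n → A) (i : Fin n) : A :=
  G i + (-((n : ℝ) + 1)⁻¹ • C.sCurv G s) * C.y i

variable {G s : Fin n → A}

/-- The trace of `P δ^i_j + P_{·j} y^i` is `nP` plus `y^m P_{·m} = P`. -/
theorem sCurv_add_mul_y {P : A} (hP : C.euler P = P) :
    C.sCurv (fun i => G i + P * C.y i) s = C.sCurv G s + ((n : ℝ) + 1) • P := by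
  have h : ∑ m, C.dy m P * C.y m = P := by
    conv_rhs => rw [← hP, euler_apply]
    exact Finset.sum_congr rfl fun _ _ => mul_comm _ _
  simp only [sCurv, N_add_mul_y, kron_self, Finset.sum_add_distrib, h, add_smul, one_smul,
    Nat.cast_smul_eq_nsmul]
  simp only [mul_one, Finset.sum_const, Finset.card_univ, Fintype.card_fin]
  ring

theorem euler_sCurv (hG : ∀ i, C.euler (G i) = 2 * G i) (hs : ∀ j m, C.dy j (s m) = 0) :
    C.euler (C.sCurv G s) = C.sCurv G s := by
  have h : ∀ m, C.euler (s m) = 0 := fun m => by simp [euler_apply, hs]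
  simp [sCurv, euler_N hG, Derivation.leibniz, h, euler_y, mul_comm]

/-- The associated spray is the projective change with factor `-S/(n + 1)`, chosen so that the shift
of `S` is `-S`. -/
theorem sCurv_assoc (hG : ∀ i, C.euler (G i) = 2 * G i) (hs : ∀ j m, C.dy j (s m) = 0) :
    C.sCurv (C.assoc G s) s = 0 := by
  have h := sCurv_add_mul_y (C := C) (G := G) (s := s) (P := -((n : ℝ) + 1)⁻¹ • C.sCurv G s)
    (by rw [Derivation.map_smul, euler_sCurv hG hs])
  have hn : ((n : ℝ) + 1) ≠ 0 := by positivity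
  unfold assoc
  rw [h, smul_smul, mul_neg, mul_inv_cancel₀ hn]
  simp

/-- The associated spray depends only on the projective class. -/
theorem assoc_add_mul_y {P : A} (hP : C.euler P = P) :
    C.assoc (fun i => G i + P * C.y i) s = C.assoc G s := by
  funext i
  have hn : ((n : ℝ) + 1) ≠ 0 := by positivity
  unfold assoc
  rw [sCurv_add_mul_y hP, smul_add, smul_smul, neg_mul, inv_mul_cancel₀ hn, neg_smul 1, one_smul]
  ring

/-- Homogeneity of `P` is not assumed: `P y^i` is a difference of two functions of degree two, and
dividing by `y^i` leaves degree one. -/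
theorem assoc_eq_of_projective {G' : Fin n → A} (hG : ∀ i, C.euler (G i) = 2 * G i)
    (hG' : ∀ i, C.euler (G' i) = 2 * G' i) {P : A} (h : ∀ i, G' i = G i + P * C.y i) :
    C.assoc G' s = C.assoc G s := by
  have hP : C.euler P = P := C.eq_of_forall_mul_y fun i => by
    have h1 := hG' i
    simp only [h, map_add, hG, Derivation.leibniz, smul_eq_mul, euler_y] at h1
    linear_combination h1
  rw [show G' = fun i => G i + P * C.y i from funext h, assoc_add_mul_y hP]

/-- `η̂ = 0` for sprays of scalar curvature. -/
theorem eta_assoc_eq_zero (hn : 3 ≤ n) (hG : ∀ i, C.euler (G i) = 2 * G i)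
    (hs : ∀ j m, C.dy j (s m) = 0) (hx : ∀ k m, C.dx k (s m) = C.dx m (s k)) {r : A}
    {t : Fin n → A} (hR : ∀ i k, C.riem2 G i k = r * kron A i k - t k * C.y i) (k : Fin n) :
    C.eta (C.assoc G s) (((n : ℝ) - 1)⁻¹ • ∑ i, C.riem2 (C.assoc G s) i i) k = 0 := by
  have hP : C.euler (-((n : ℝ) + 1)⁻¹ • C.sCurv G s) = -((n : ℝ) + 1)⁻¹ • C.sCurv G s := by
    rw [Derivation.map_smul, euler_sCurv hG hs]
  have hE : ∀ i, C.euler (C.assoc G s i) = 2 * C.assoc G s i := euler_add_mul_y hG hP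
  have hR' := riem2_add_mul_y hG hP hR
  change ∀ i k, C.riem2 (C.assoc G s) i k = _ at hR'
  -- The trace shows that the curvature scalar of `Ĝ` is the coefficient of `δ^i_k` in its isotropic
  -- form.
  have htr := trace_riem2 hE hR'
  have hn1 : ((n : ℝ) - 1) ≠ 0 := by
    have : (3 : ℝ) ≤ n := by exact_mod_cast hn
    linarith
  have hr : ∀ a : A, ((n : ℝ) - 1)⁻¹ • (((n : A) - 1) * a) = a := fun a => by
    have h : ((n : A) - 1) * a = ((n : ℝ) - 1) • a := by
      rw [sub_smul, one_smul, Nat.cast_smul_eq_nsmul, nsmul_eq_mul]; ring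
    rw [h, smul_smul, inv_mul_cancel₀ hn1, one_smul]
  rw [htr, hr]
  -- Zero S-curvature says that the trace of `N` is `y^m s_m`, and closedness of `s` then kills the
  -- curvature trace.
  exact eta_eq_zero_of_isotropic hn hE hR'
    (sum_dy_curv_eq_zero s (sub_eq_zero.1 (sCurv_assoc hG hs)) hs hx) k

end SCurvature

end FibreCalculus

/-! ### The algebra of smooth functions on an open set. -/

section SmoothFunctions

variable {E : Type*} [NormedAddCommGroup E] [NormedSpace ℝ E]

/-- The algebra of smooth real functions on an open set. -/
def smoothFns (U : TopologicalSpace.Opens E) : Subalgebra ℝ (U → ℝ) where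
  carrier := {f | ∃ g : E → ℝ, ContDiffOn ℝ ∞ g U ∧ ∀ z : U, f z = g z}
  mul_mem' := by
    rintro f f' ⟨g, hg, h⟩ ⟨g', hg', h'⟩
    exact ⟨fun z => g z * g' z, hg.mul hg', fun z => by simp [h, h']⟩
  add_mem' := by
    rintro f f' ⟨g, hg, h⟩ ⟨g', hg', h'⟩
    exact ⟨fun z => g z + g' z, hg.add hg', fun z => by simp [h, h']⟩
  algebraMap_mem' c := ⟨fun _ => c, contDiffOn_const, fun _ => rfl⟩

variable {U : TopologicalSpace.Opens E}

/-- `g` extends the function `a` on `U`. -/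
def Extends (a : smoothFns U) (g : E → ℝ) : Prop := ∀ z : U, a.1 z = g z

theorem exists_extends (a : smoothFns U) : ∃ g, Extends a g := by
  obtain ⟨g, -, h⟩ := a.2
  exact ⟨g, h⟩

theorem Extends.contDiffOn {a : smoothFns U} {g : E → ℝ} (h : Extends a g) :
    ContDiffOn ℝ ∞ g U := by
  obtain ⟨g', hg', h'⟩ := a.2
  exact hg'.congr fun z hz => (h ⟨z, hz⟩).symm.trans (h' ⟨z, hz⟩)

theorem Extends.differentiableAt {a : smoothFns U} {g : E → ℝ} (h : Extends a g) {z : E}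
    (hz : z ∈ U) : DifferentiableAt ℝ g z :=
  (h.contDiffOn.contDiffAt (U.isOpen.mem_nhds hz)).differentiableAt (by simp)

/-- Two extensions agree near each point of the open set `U`, so the derivative there does not
depend on the one chosen. -/
theorem Extends.fderiv_eq {a : smoothFns U} {g g' : E → ℝ} (h : Extends a g) (h' : Extends a g')
    {z : E} (hz : z ∈ U) : fderiv ℝ g z = fderiv ℝ g' z := by
  refine Filter.EventuallyEq.fderiv_eq ?_
  filter_upwards [U.isOpen.mem_nhds hz] with w hw
  exact (h ⟨w, hw⟩).symm.trans (h' ⟨w, hw⟩)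

/-- A smooth function as an element of `smoothFns U`. -/
def toSmooth (g : E → ℝ) (hg : ContDiffOn ℝ ∞ g U) : smoothFns U :=
  ⟨fun z => g z, g, hg, fun _ => rfl⟩

theorem toSmooth_extends {g : E → ℝ} (hg : ContDiffOn ℝ ∞ g U) : Extends (toSmooth g hg) g :=
  fun _ => rfl

/-- Elements of the algebra are functions on `U` only. Analytic identities valid on `U` become
identities in the algebra through this lemma. -/
theorem Extends.unique {a b : smoothFns U} {g : E → ℝ} (ha : Extends a g) (hb : Extends b g) :
    a = b :=
  Subtype.ext (funext fun z => (ha z).trans (hb z).symm)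

theorem Extends.add {a b : smoothFns U} {f g : E → ℝ} (ha : Extends a f) (hb : Extends b g) :
    Extends (a + b) fun z => f z + g z :=
  fun z => congrArg₂ (· + ·) (ha z) (hb z)

theorem Extends.sub {a b : smoothFns U} {f g : E → ℝ} (ha : Extends a f) (hb : Extends b g) :
    Extends (a - b) fun z => f z - g z :=
  fun z => congrArg₂ (· - ·) (ha z) (hb z)

theorem Extends.mul {a b : smoothFns U} {f g : E → ℝ} (ha : Extends a f) (hb : Extends b g) :
    Extends (a * b) fun z => f z * g z :=
  fun z => congrArg₂ (· * ·) (ha z) (hb z)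

theorem Extends.smul {a : smoothFns U} {f : E → ℝ} (c : ℝ) (ha : Extends a f) :
    Extends (c • a) fun z => c * f z :=
  fun z => congrArg (c * ·) (ha z)

theorem Extends.sum {ι : Type*} {s : Finset ι} {a : ι → smoothFns U} {f : ι → E → ℝ}
    (h : ∀ i, Extends (a i) (f i)) : Extends (∑ i ∈ s, a i) fun z => ∑ i ∈ s, f i z := by
  intro z
  have h1 : (∑ i ∈ s, a i).1 = ∑ i ∈ s, (a i).1 := map_sum (smoothFns U).val a s
  rw [h1, Finset.sum_apply]
  exact Finset.sum_congr rfl fun i _ => h i z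

/-- The directional derivative as a function on `smoothFns U`. -/
def dirFun (v : E) (a : smoothFns U) : smoothFns U :=
  toSmooth (fun z => fderiv ℝ (exists_extends a).choose z v)
    (((exists_extends a).choose_spec.contDiffOn.fderiv_of_isOpen U.isOpen le_rfl).clm_apply
      contDiffOn_const)

theorem Extends.dirFun {a : smoothFns U} {g : E → ℝ} (h : Extends a g) (v : E) :
    Extends (dirFun v a) fun z => fderiv ℝ g z v :=
  fun z => congrArg (fun L : E →L[ℝ] ℝ => L v) ((exists_extends a).choose_spec.fderiv_eq h z.2)

/-- The directional derivative. -/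
def dirDeriv (v : E) : Derivation ℝ (smoothFns U) (smoothFns U) :=
  Derivation.mk'
    { toFun := dirFun v
      map_add' := fun a b => by
        obtain ⟨f, hf⟩ := exists_extends a
        obtain ⟨g, hg⟩ := exists_extends b
        refine Subtype.ext (funext fun z => ?_)
        rw [(hf.add hg).dirFun v z, ((hf.dirFun v).add (hg.dirFun v)) z]
        beta_reduce
        rw [fderiv_fun_add (hf.differentiableAt z.2) (hg.differentiableAt z.2)]
        rfl
      map_smul' := fun c a => by
        obtain ⟨f, hf⟩ := exists_extends a
        refine Subtype.ext (funext fun z => ?_)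
        rw [(hf.smul c).dirFun v z, RingHom.id_apply, ((hf.dirFun v).smul c) z]
        beta_reduce
        rw [fderiv_const_mul (hf.differentiableAt z.2)]
        rfl }
    fun a b => by
      obtain ⟨f, hf⟩ := exists_extends a
      obtain ⟨g, hg⟩ := exists_extends b
      refine Subtype.ext (funext fun z => ?_)
      refine ((hf.mul hg).dirFun v z).trans (Eq.trans ?_
        (((hf.mul (hg.dirFun v)).add (hg.mul (hf.dirFun v))) z).symm)
      beta_reduce
      rw [fderiv_fun_mul (hf.differentiableAt z.2) (hg.differentiableAt z.2)]
      rfl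

theorem Extends.dirDeriv {a : smoothFns U} {g : E → ℝ} (h : Extends a g) (v : E) :
    Extends (dirDeriv v a) fun z => fderiv ℝ g z v :=
  h.dirFun v

theorem dirDeriv_comm (v w : E) (a : smoothFns U) :
    dirDeriv v (dirDeriv w a) = dirDeriv w (dirDeriv v a) := by
  obtain ⟨g, hg⟩ := exists_extends a
  have h : ∀ v w : E, ∀ z : U, (dirDeriv v (dirDeriv w a)).1 z = fderiv ℝ (fderiv ℝ g) z v w := by
    intro v w z
    rw [(hg.dirDeriv w).dirDeriv v z]
    have h1 : DifferentiableAt ℝ (fderiv ℝ g) z :=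
      ((hg.contDiffOn.fderiv_of_isOpen U.isOpen le_rfl).contDiffAt
        (U.isOpen.mem_nhds z.2) : ContDiffAt ℝ ∞ _ _).differentiableAt (by simp)
    beta_reduce
    rw [fderiv_clm_apply h1 (differentiableAt_const w)]
    simp
  refine Subtype.ext (funext fun z => ?_)
  rw [h v w, h w v]
  exact (hg.contDiffOn.contDiffAt (U.isOpen.mem_nhds z.2)).isSymmSndFDerivAt (by
    rw [minSmoothness_of_isRCLikeNormedField]
    exact WithTop.coe_le_coe.2 le_top) v w

end SmoothFunctions

/-! ### From coordinate formulas to the abstract calculus. -/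

section Transfer

variable {n : ℕ} {U : TopologicalSpace.Opens (Coord n × Coord n)}

/-- The fibre coordinate `yⁱ`. -/
def fibreCoord (U : TopologicalSpace.Opens (Coord n × Coord n)) (i : Fin n) : smoothFns U :=
  toSmooth (fun z => z.2 i)
    ((EuclideanSpace.proj i : Coord n →L[ℝ] ℝ).contDiff.comp contDiff_snd).contDiffOn

theorem dirDeriv_fibreCoord (a b : Coord n) (i : Fin n) :
    dirDeriv (a, b) (fibreCoord U i) = algebraMap ℝ _ (b i) := by
  refine Extends.unique (((toSmooth_extends _).dirDeriv (a, b))) ?_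
  intro z
  have h : HasFDerivAt (fun z : Coord n × Coord n => z.2 i)
      ((EuclideanSpace.proj i : Coord n →L[ℝ] ℝ).comp (ContinuousLinearMap.snd ℝ _ _)) z :=
    ((EuclideanSpace.proj i : Coord n →L[ℝ] ℝ).comp
      (ContinuousLinearMap.snd ℝ (Coord n) (Coord n))).hasFDerivAt
  beta_reduce
  rw [h.fderiv]
  rfl

theorem sum_mul_self_ne_zero {y : Coord n} (hy : y ≠ 0) : ∑ i, y i * y i ≠ 0 := by
  intro h
  refine hy (PiLp.ext fun i => ?_)
  have h1 := (Finset.sum_eq_zero_iff_of_nonneg fun i _ => mul_self_nonneg (y i)).1 h i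
    (Finset.mem_univ i)
  exact mul_self_eq_zero.1 h1

/-- The calculus of smooth functions on an open set of nonzero tangent vectors. -/
def smoothCalculus (U : TopologicalSpace.Opens (Coord n × Coord n)) (hU : ∀ z ∈ U, z.2 ≠ 0) :
    FibreCalculus n (smoothFns U) where
  dx k := dirDeriv (stdVec k, 0)
  dy k := dirDeriv (0, stdVec k)
  y := fibreCoord U
  sqInv := toSmooth (fun z => (∑ i, z.2 i * z.2 i)⁻¹) (by
    have h : ∀ i, ContDiff ℝ ∞ (fun z : Coord n × Coord n => z.2 i) := fun i =>
      (EuclideanSpace.proj i : Coord n →L[ℝ] ℝ).contDiff.comp contDiff_snd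
    exact ContDiffOn.inv (ContDiff.sum fun i _ => (h i).mul (h i)).contDiffOn
      fun z hz => sum_mul_self_ne_zero (hU z hz))
  dx_dx _ _ _ := dirDeriv_comm _ _ _
  dx_dy _ _ _ := dirDeriv_comm _ _ _
  dy_dy _ _ _ := dirDeriv_comm _ _ _
  dx_y i j := by
    rw [dirDeriv_fibreCoord]
    simp
  dy_y i j := by
    rw [dirDeriv_fibreCoord]
    by_cases h : i = j <;> simp [h]
  sqInv_mul := by
    refine Extends.unique ((toSmooth_extends _).mul (Extends.sum fun i =>
      (toSmooth_extends _).mul (toSmooth_extends _))) ?_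
    intro z
    exact (inv_mul_cancel₀ (sum_mul_self_ne_zero (hU z z.2))).symm

/-- `f(x, y)` restricts to the element `a` of `smoothFns U`. -/
def Rep (a : smoothFns U) (f : Coord n → Coord n → ℝ) : Prop := Extends a fun z => f z.1 z.2

variable {hU : ∀ z ∈ U, z.2 ≠ 0}

theorem Rep.pdx {a : smoothFns U} {f : Coord n → Coord n → ℝ} (h : Rep a f) (k : Fin n) :
    Rep ((smoothCalculus U hU).dx k a) (pdx k f) := by
  intro z
  refine (h.dirDeriv (stdVec k, 0) z).trans ?_
  have h1 : HasFDerivAt (fun x => f x z.1.2) _ z.1.1 :=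
    HasFDerivAt.comp z.1.1 (g := fun z : Coord n × Coord n => f z.1 z.2) (f := fun x => (x, z.1.2))
      (h.differentiableAt z.2).hasFDerivAt (hasFDerivAt_prodMk_left z.1.1 z.1.2)
  unfold SprayGeometry.pdx
  beta_reduce
  rw [h1.fderiv]
  rfl

theorem Rep.pdy {a : smoothFns U} {f : Coord n → Coord n → ℝ} (h : Rep a f) (k : Fin n) :
    Rep ((smoothCalculus U hU).dy k a) (pdy k f) := by
  intro z
  refine (h.dirDeriv (0, stdVec k) z).trans ?_
  have h1 : HasFDerivAt (fun y => f z.1.1 y) _ z.1.2 :=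
    HasFDerivAt.comp z.1.2 (g := fun z : Coord n × Coord n => f z.1 z.2) (f := fun y => (z.1.1, y))
      (h.differentiableAt z.2).hasFDerivAt (hasFDerivAt_prodMk_right z.1.1 z.1.2)
  unfold SprayGeometry.pdy
  beta_reduce
  rw [h1.fderiv]
  rfl

theorem rep_y (i : Fin n) : Rep ((smoothCalculus U hU).y i) fun _ y => y i := fun _ => rfl

section Spray

variable {G : Coord n → Coord n → Coord n} {g : Fin n → smoothFns U}
  (hG : ∀ i, Rep (g i) fun x y => G x y i)
include hG

theorem rep_connN (i j : Fin n) : Rep ((smoothCalculus U hU).N g i j) (connN G i j) :=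
  (hG i).pdy j

theorem rep_berwaldΓ (i j k : Fin n) : Rep ((smoothCalculus U hU).Γ g i j k) (berwaldΓ G i j k) :=
  (rep_connN hG i j).pdy k

theorem rep_hor (k : Fin n) {a : smoothFns U} {f : Coord n → Coord n → ℝ} (h : Rep a f) :
    Rep ((smoothCalculus U hU).hor g k a) (hor G k f) := by
  rw [FibreCalculus.hor_apply]
  exact Extends.sub (h.pdx k) (Extends.sum fun m => Extends.mul (rep_connN hG m k) (h.pdy m))

theorem rep_riemann4 (j i k l : Fin n) :
    Rep ((smoothCalculus U hU).riem g j i k l) (riemann4 G j i k l) :=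
  Extends.add (Extends.sub (rep_hor hG k (rep_berwaldΓ hG i j l))
    (rep_hor hG l (rep_berwaldΓ hG i j k))) (Extends.sum fun s => Extends.sub
      (Extends.mul (rep_berwaldΓ hG i k s) (rep_berwaldΓ hG s j l))
      (Extends.mul (rep_berwaldΓ hG s j k) (rep_berwaldΓ hG i l s)))

theorem rep_riemann2 (i k : Fin n) :
    Rep ((smoothCalculus U hU).riem2 g i k) (riemann2 G i k) :=
  Extends.sum fun j => Extends.sum fun l =>
    Extends.mul (Extends.mul (rep_y j) (rep_riemann4 hG j i k l)) (rep_y l)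

theorem rep_scalR :
    Rep (((n : ℝ) - 1)⁻¹ • ∑ i, (smoothCalculus U hU).riem2 g i i) (scalR G) := by
  intro z
  refine ((Extends.sum fun i => rep_riemann2 hG i i).smul ((n : ℝ) - 1)⁻¹ z).trans ?_
  simp only [scalR, ricci, div_eq_inv_mul]

theorem rep_localEta (k : Fin n) :
    Rep ((smoothCalculus U hU).eta g (((n : ℝ) - 1)⁻¹ • ∑ i, (smoothCalculus U hU).riem2 g i i) k)
      (localEta G k) := by
  have h := rep_scalR (hU := hU) hG
  exact Extends.sub (Extends.smul (1 / 2) (Extends.sum fun m => Extends.mul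
    (Extends.sub (rep_hor hG m (h.pdy k)) (Extends.sum fun s =>
      Extends.mul (rep_berwaldΓ hG s k m) (h.pdy s))) (rep_y m))) (rep_hor hG k h)

theorem rep_localS {σ : Coord n → ℝ} {s : Fin n → smoothFns U}
    (hs : ∀ m, Rep (s m) (pdx m fun x _ => Real.log (σ x))) :
    Rep ((smoothCalculus U hU).sCurv g s) (localS G σ) :=
  Extends.sub (Extends.sum fun m => (hG m).pdy m)
    (Extends.sum fun m => Extends.mul (rep_y m) (hs m))

end Spray

end Transfer

/-! ### Euler's identity and division by the fibre coordinates. -/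

section Homogeneity

variable {n : ℕ} {U : TopologicalSpace.Opens (Coord n × Coord n)} {hU : ∀ z ∈ U, z.2 ≠ 0}

theorem sum_mul_fderiv_stdVec (L : Coord n →L[ℝ] ℝ) (y : Coord n) :
    ∑ m, y m * L (stdVec m) = L y := by
  have hy : y = ∑ m, y m • (stdVec m : Coord n) := by
    simpa using ((EuclideanSpace.basisFun (Fin n) ℝ).sum_repr y).symm
  conv_rhs => rw [hy, map_sum]
  exact Finset.sum_congr rfl fun m _ => by rw [map_smul, smul_eq_mul]

/-- Euler's identity for positively homogeneous functions of degree two. -/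
theorem euler_eq_two_mul {a : smoothFns U} {f : Coord n → Coord n → ℝ} (h : Rep a f)
    (hf : ∀ z ∈ U, ∀ c : ℝ, 0 < c → f z.1 (c • z.2) = c ^ 2 * f z.1 z.2) :
    (smoothCalculus U hU).euler a = 2 * a := by
  rw [FibreCalculus.euler_apply, two_mul]
  refine Extends.unique (Extends.sum fun m => Extends.mul (rep_y m) (h.pdy m)) ?_
  intro z
  refine (Extends.add h h z).trans ?_
  have hd : DifferentiableAt ℝ (f z.1.1) z.1.2 :=
    DifferentiableAt.comp (g := fun z : Coord n × Coord n => f z.1 z.2) (f := fun y => (z.1.1, y))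
      z.1.2 (h.differentiableAt z.2) (by fun_prop)
  refine Eq.trans ?_ (sum_mul_fderiv_stdVec (fderiv ℝ (f z.1.1) z.1.2) z.1.2).symm
  -- Both sides of `f(x, c y) = c² f(x, y)` are differentiated at `c = 1`; validity for `c > 0`
  -- suffices, being a neighbourhood of `1`.
  have h1 : HasDerivAt (fun c : ℝ => c • z.1.2) z.1.2 1 := by
    simpa using (hasDerivAt_id (1 : ℝ)).smul_const z.1.2
  have h2 : HasDerivAt (fun c : ℝ => f z.1.1 (c • z.1.2)) (fderiv ℝ (f z.1.1) z.1.2 z.1.2) 1 :=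
    hd.hasFDerivAt.comp_hasDerivAt_of_eq (1 : ℝ) h1 (one_smul ℝ _).symm
  have h3 : HasDerivAt (fun c : ℝ => c ^ 2 * f z.1.1 z.1.2) (2 * f z.1.1 z.1.2) 1 := by
    simpa using (hasDerivAt_pow 2 (1 : ℝ)).mul_const (f z.1.1 z.1.2)
  have h4 := h3.congr_of_eventuallyEq (f₁ := fun c : ℝ => f z.1.1 (c • z.1.2)) (by
    filter_upwards [lt_mem_nhds (zero_lt_one' ℝ)] with c hc using hf z z.2 c hc)
  rw [h2.unique h4, two_mul]

/-- If all `c y^i` are smooth, so is `c = ∑ (c y^i) y^i / ∑ y^i y^i`. The projective factor `P` and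
the covector `τ_k` are given as bare functions and get their smoothness from here. -/
theorem exists_rep_of_mul_fibreCoord (hU : ∀ z ∈ U, z.2 ≠ 0) {c : Coord n → Coord n → ℝ} {a : Fin n → smoothFns U}
    (h : ∀ i, Rep (a i) fun x y => c x y * y i) : ∃ p : smoothFns U, Rep p c := by
  refine ⟨(smoothCalculus U hU).sqInv * ∑ i, a i * (smoothCalculus U hU).y i, fun z => ?_⟩
  have h1 : Extends (smoothCalculus U hU).sqInv fun z => (∑ i, z.2 i * z.2 i)⁻¹ := fun _ => rfl
  refine (Extends.mul h1 (Extends.sum fun i => Extends.mul (h i) (rep_y i)) z).trans ?_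
  simp only [mul_assoc, ← Finset.mul_sum]
  rw [mul_left_comm, inv_mul_cancel₀ (sum_mul_self_ne_zero (hU z z.2)), mul_one]

end Homogeneity

/-! ### Sprays and volume forms in a chart. -/

section Charts

variable {n : ℕ} {M : Type*} [TopologicalSpace M] [ChartedSpace (Coord n) M]
  [IsManifold (𝓡 n) ∞ M]

/-- The nonzero tangent vectors over the domain of a chart, in coordinates. -/
def slit (e : OpenPartialHomeomorph M (Coord n)) : TopologicalSpace.Opens (Coord n × Coord n) :=
  ⟨e.target ×ˢ {y | y ≠ 0}, isOpen_slit⟩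

/-- The calculus of smooth functions of nonzero tangent vectors in a chart. -/
abbrev chartCalculus (e : OpenPartialHomeomorph M (Coord n)) :
    FibreCalculus n (smoothFns (slit e)) :=
  smoothCalculus (slit e) fun _ hz => hz.2

variable {e : OpenPartialHomeomorph M (Coord n)}

theorem exists_rep_coeff (G : Spray n M) (he : e ∈ IsManifold.maximalAtlas (𝓡 n) ∞ M) :
    ∃ g : Fin n → smoothFns (slit e), (∀ i, Rep (g i) fun x y => G.coeff e x y i) ∧
      ∀ i, (chartCalculus e).euler (g i) = 2 * g i := by
  have hs : ∀ i, ContDiffOn ℝ ∞ (fun z : Coord n × Coord n => G.coeff e z.1 z.2 i) (slit e) :=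
    fun i => (EuclideanSpace.proj i : Coord n →L[ℝ] ℝ).contDiff.comp_contDiffOn (G.smooth e he)
  refine ⟨fun i => toSmooth _ (hs i), fun i => toSmooth_extends _, fun i =>
    euler_eq_two_mul (f := fun x y => G.coeff e x y i) (toSmooth_extends (hs i)) fun z hz c hc => ?_⟩
  exact congrArg (fun v : Coord n => v i) (G.homog e he z.1 hz.1 z.2 c hc)

/-- The `s_m` are the `x`-gradient of `ln σ`, a function of `x` alone; both properties follow
because the derivations commute. -/
theorem exists_rep_log (dV : VolumeForm n M) (he : e ∈ IsManifold.maximalAtlas (𝓡 n) ∞ M) :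
    ∃ s : Fin n → smoothFns (slit e),
      (∀ m, Rep (s m) (pdx m fun x _ => Real.log (dV.coeff e x))) ∧
      (∀ j m, (chartCalculus e).dy j (s m) = 0) ∧
      ∀ k m, (chartCalculus e).dx k (s m) = (chartCalculus e).dx m (s k) := by
  have hs : ContDiffOn ℝ ∞ (fun z : Coord n × Coord n => Real.log (dV.coeff e z.1)) (slit e) :=
    (dV.contDiffOn_log he).comp contDiffOn_fst fun z hz => hz.1
  have h : Rep (toSmooth _ hs) fun x _ => Real.log (dV.coeff e x) := toSmooth_extends _
  refine ⟨fun m => (chartCalculus e).dx m (toSmooth _ hs), fun m => h.pdx m, fun j m => ?_,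
    fun k m => (chartCalculus e).dx_dx _ _ _⟩
  have h0 : (chartCalculus e).dy j (toSmooth _ hs) = 0 := by
    refine Extends.unique (h.pdy j) fun z => ?_
    simp only [pdy, fderiv_fun_const]
    rfl
  rw [← (chartCalculus e).dx_dy, h0, map_zero]

theorem rep_associated (G : Spray n M) (dV : VolumeForm n M)
    (he : e ∈ IsManifold.maximalAtlas (𝓡 n) ∞ M) {g s : Fin n → smoothFns (slit e)}
    (hg : ∀ i, Rep (g i) fun x y => G.coeff e x y i)
    (hs : ∀ m, Rep (s m) (pdx m fun x _ => Real.log (dV.coeff e x))) (i : Fin n) :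
    Rep ((chartCalculus e).assoc g s i) fun x y => (G.associated dV).coeff e x y i := by
  intro z
  refine (Extends.add (hg i) (Extends.mul (Extends.smul _ (rep_localS hg hs)) (rep_y i)) z).trans ?_
  beta_reduce
  rw [G.associated_coeff dV he z.2.1]
  simp only [PiLp.sub_apply, PiLp.smul_apply, smul_eq_mul]
  ring

/-- Smoothness of `P` on nonzero vectors comes from that of `P y^i = G'^i - G^i`. -/
theorem exists_projective_factor {G G' : Spray n M} (h : G.ProjEquiv G')
    (he : e ∈ IsManifold.maximalAtlas (𝓡 n) ∞ M) {g g' : Fin n → smoothFns (slit e)}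
    (hg : ∀ i, Rep (g i) fun x y => G.coeff e x y i)
    (hg' : ∀ i, Rep (g' i) fun x y => G'.coeff e x y i) :
    ∃ p, ∀ i, g' i = g i + p * (chartCalculus e).y i := by
  obtain ⟨P, hP⟩ := h
  have hPe : ∀ z ∈ slit e, ∀ i, G'.coeff e z.1 z.2 i =
      G.coeff e z.1 z.2 i + P (coordVec e z.1 z.2) * z.2 i := fun z hz i => by
    rw [hP e he z.1 hz.1 z.2 hz.2]
    rfl
  obtain ⟨p, hp⟩ := exists_rep_of_mul_fibreCoord (U := slit e) (fun _ hz => hz.2)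
    (c := fun x y => P (coordVec e x y)) (a := fun i => g' i - g i) fun i z => by
      refine (Extends.sub (hg' i) (hg i) z).trans ?_
      beta_reduce
      rw [hPe z z.2]
      ring
  refine ⟨p, fun i => Extends.unique (hg' i) fun z => ?_⟩
  exact (Extends.add (hg i) (Extends.mul hp (rep_y i)) z).trans (hPe z z.2 i).symm

/-- Smoothness of `τ_k` comes from `τ_k y^i = R δ^i_k - R^i_k`. -/
theorem exists_isotropic_form {G : Spray n M} (h : G.IsOfScalarCurvature)
    (he : e ∈ IsManifold.maximalAtlas (𝓡 n) ∞ M) {g : Fin n → smoothFns (slit e)}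
    (hg : ∀ i, Rep (g i) fun x y => G.coeff e x y i) :
    ∃ (r : smoothFns (slit e)) (t : Fin n → smoothFns (slit e)), ∀ i k,
      (chartCalculus e).riem2 g i k = r * kron _ i k - t k * (chartCalculus e).y i := by
  obtain ⟨τ, hτ⟩ := h e he
  set r := ((n : ℝ) - 1)⁻¹ • ∑ i, (chartCalculus e).riem2 g i i with hr
  have hk : ∀ i k : Fin n, Extends (U := slit e) (kron _ i k) fun _ => if i = k then 1 else 0 := by
    intro i k z
    unfold kron
    split_ifs <;> rfl
  have hR : ∀ i k, Rep ((chartCalculus e).riem2 g i k) (riemann2 (G.coeff e) i k) :=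
    rep_riemann2 hg
  have hrk : ∀ i k, Extends (r * kron _ i k) _ := fun i k => Extends.mul (rep_scalR hg) (hk i k)
  have ht : ∀ k, ∃ p : smoothFns (slit e), Rep p (τ k) := fun k =>
    exists_rep_of_mul_fibreCoord (U := slit e) (fun _ hz => hz.2)
      (a := fun i => r * kron _ i k - (chartCalculus e).riem2 g i k) fun i z => by
        refine ((hrk i k).sub (hR i k) z).trans ?_
        beta_reduce
        rw [(hτ z.1.1 z.2.1 z.1.2 z.2.2).2.2 i k]
        ring
  choose t ht using ht
  refine ⟨r, t, fun i k => Extends.unique (hR i k) fun z => ?_⟩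
  exact ((hrk i k).sub (Extends.mul (ht k) (rep_y i)) z).trans
    ((hτ z.1.1 z.2.1 z.1.2 z.2.2).2.2 i k).symm

end Charts

end SprayGeometry

end

/-! ### The theorem, by evaluating identities of the calculus at a point. -/

theorem mainTheorem8 {n : ℕ} (hn : 3 ≤ n) {M : Type*} [TopologicalSpace M]
    [ChartedSpace (SprayGeometry.Coord n) M] [IsManifold (𝓡 n) ∞ M]
    (G : SprayGeometry.Spray n M) (dV : SprayGeometry.VolumeForm n M) :
    (∀ G' : SprayGeometry.Spray n M, G.ProjEquiv G' →
      ∀ e ∈ IsManifold.maximalAtlas (𝓡 n) ∞ M, ∀ x ∈ e.target,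
        ∀ y : SprayGeometry.Coord n, y ≠ 0 → ∀ k : Fin n,
          G'.etaHat dV e k x y = G.etaHat dV e k x y) ∧
    (G.IsOfScalarCurvature →
      ∀ e ∈ IsManifold.maximalAtlas (𝓡 n) ∞ M, ∀ x ∈ e.target,
        ∀ y : SprayGeometry.Coord n, y ≠ 0 → ∀ k : Fin n,
          G.etaHat dV e k x y = 0) := by
  open SprayGeometry in
  refine ⟨fun G' hGG' e he x hx y hy k => ?_, fun hG e he x hx y hy k => ?_⟩
  · obtain ⟨g, hg, hgE⟩ := exists_rep_coeff G he
    obtain ⟨g', hg', hgE'⟩ := exists_rep_coeff G' he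
    obtain ⟨s, hs, -, -⟩ := exists_rep_log dV he
    obtain ⟨p, hp⟩ := exists_projective_factor hGG' he hg hg'
    have h : Rep _ (G.etaHat dV e k) :=
      rep_localEta (U := slit e) (hU := fun _ hz => hz.2) (rep_associated G dV he hg hs) k
    have h' : Rep _ (G'.etaHat dV e k) :=
      rep_localEta (U := slit e) (hU := fun _ hz => hz.2) (rep_associated G' dV he hg' hs) k
    -- The two associated sprays are the same in the algebra, so both `η̂` are represented by one
    -- element.
    rw [FibreCalculus.assoc_eq_of_projective hgE hgE' hp] at h'
    exact (h' ⟨(x, y), hx, hy⟩).symm.trans (h ⟨(x, y), hx, hy⟩)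
  · obtain ⟨g, hg, hgE⟩ := exists_rep_coeff G he
    obtain ⟨s, hs, hsy, hsx⟩ := exists_rep_log dV he
    obtain ⟨r, t, hR⟩ := exists_isotropic_form hG he hg
    have h : Rep _ (G.etaHat dV e k) :=
      rep_localEta (U := slit e) (hU := fun _ hz => hz.2) (rep_associated G dV he hg hs) k
    rw [FibreCalculus.eta_assoc_eq_zero hn hgE hsy hsx hR k] at h
    exact (h ⟨(x, y), hx, hy⟩).symm
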